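/- Consider edge-to-edge tilings of the sphere by pentagons (simple closed pentagons, the tiling being taken up to homeomorphism of the sphere, possibly orientation reversing), in which every corner of every tile carries one of the symbols $\alpha,\beta,\gamma,\delta$. The tiles are required to be corner congruent: there is one cyclic arrangement of the five symbols $\alpha,\alpha,\beta,\gamma,\delta$ such that the corners of each tile, read clockwise or counterclockwise, are in this arrangement. (No actual angle values are involved.) Such a tiling is a tiling for $$\text{AVC(4D24)}=\{24\,\alpha^2\beta\gamma\delta:\ 24\,\alpha\beta\gamma,\ 8\,\alpha^3,\ 6\,\delta^4\}$$ if it has $24$ tiles and its vertices are exactly $24$ vertices with corners $\alpha,\beta,\gamma$, $8$ vertices with corners $\alpha,\alpha,\alpha$, and $6$ vertices with corners $\delta,\delta,\delta,\delta$; and it is a tiling for $$\text{AVC(4D60)}=\{60\,\alpha^2\beta\gamma\delta:\ 60\,\alpha\beta\gamma,\ 20\,\alpha^3,\ 12\,\delta^5\}$$ if it has $60$ tiles and its vertices are exactly $60$ vertices $\alpha\beta\gamma$, $20$ vertices $\alpha^3$ and $12$ vertices $\delta^5$. Let $PP_6$ and $PP_{12}$ be the pentagonal subdivisions of the cube and of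 the dodecahedron: each edge is divided into three parts by two new points; each face gets a new point $c$ in its middle; traversing the boundary of the face counterclockwise, $c$ is joined to the second new point of every edge. This gives one pentagon for each face and each vertex $v$ of that face. Its corners are, in counterclockwise order, $c$, the second new point of the edge of the face before $v$, the vertex $v$, and the first and the second new point of the edge of the face after $v$; they are labelled $\epsilon,\alpha,\delta,\beta,\gamma$ in this order. The $4\mathrm{D}_1$, $4\mathrm{D}_2$, $4\mathrm{D}_3$ reductions of $PP_6$ and $PP_{12}$ are obtained by changing the labels $\alpha,\beta,\gamma,\delta,\epsilon$ into, respectively, $$\alpha,\gamma,\beta,\alpha,\delta;\qquad \beta,\alpha,\gamma,\alpha,\delta;\qquad \beta,\gamma,\alpha,\alpha,\delta.$$ For a vertex $v=\delta^4$ (or $\delta^5$) let $N(v)$ be the set of the tiles touching $v$. In the $4\mathrm{D}_2$ reduction these are disjoint sets of four (five) tiles; changing the orientation of $N(v)$ means exchanging the labels $\beta$ and $\gamma$ in all the tiles of $N(v)$. Theorem. Up to the exchange of $\beta$ and $\gamma$ (in all the tiles), the tilings for AVC(4D24) are exactly the $4\mathrm{D}_1$, $4\mathrm{D}_2$ and $4\mathrm{D}_3$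 reductions of $PP_6$ and the modifications of the $4\mathrm{D}_2$ reduction of $PP_6$ obtained by changing the orientations of the $N(v)$ for an arbitrary set of vertices $v=\delta^4$. Up to the exchange of $\beta$ and $\gamma$, the tilings for AVC(4D60) are exactly the $4\mathrm{D}_1$, $4\mathrm{D}_2$ and $4\mathrm{D}_3$ reductions of $PP_{12}$ and the modifications of the $4\mathrm{D}_2$ reduction of $PP_{12}$ obtained by changing the orientations of the $N(v)$ for an arbitrary set of vertices $v=\delta^5$. -/

import Mathlib

noncomputable section

namespace PentTiling

/-- The symbols used for the corners (angles) of a pentagon. -/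
inductive Corner where
  | α | β | γ | δ | ε
  deriving DecidableEq

/-- A combinatorial oriented surface tiling (rotation system). `D` is the set of sides of tiles,
each side being directed counterclockwise around its tile: `next d` is the side following `d`
counterclockwise around the same tile, and `flip d` is the same edge seen as a side of the tile on
its other side (with the reversed direction). Every `d` also stands for the corner of its tile at
the starting point of `d`. -/
structure OrientedMap (D : Type*) where
  next : Equiv.Perm D
  flip : Equiv.Perm D
  flip_flip : ∀ d, flip (flip d) = d
  flip_ne : ∀ d, flip d ≠ d

namespace OrientedMap

/-- The next side, counterclockwise, among those starting at the same vertex as `d`. -/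
def around {D : Type*} (M : OrientedMap D) : Equiv.Perm D := M.flip * M.next⁻¹

/-- Tiles, edges and vertices are the orbits of `next`, `flip` and `around`. -/
def Tile {D : Type*} (M : OrientedMap D) : Type _ :=
  Quotient (Equiv.Perm.SameCycle.setoid M.next)

def Edge {D : Type*} (M : OrientedMap D) : Type _ :=
  Quotient (Equiv.Perm.SameCycle.setoid M.flip)

def Vertex {D : Type*} (M : OrientedMap D) : Type _ :=
  Quotient (Equiv.Perm.SameCycle.setoid M.around)

/-- The tile that `d` is a side of. -/
def tileOf {D : Type*} (M : OrientedMap D) (d : D) : M.Tile := Quotient.mk _ d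

/-- The starting point of `d`. -/
def vertexOf {D : Type*} (M : OrientedMap D) (d : D) : M.Vertex := Quotient.mk _ d

/-- The surface is connected and has Euler characteristic `2`, i.e. it is the sphere
(`D` is finite wherever this is used). -/
def IsSphere {D : Type*} (M : OrientedMap D) : Prop :=
  (∀ d e : D, ∃ g ∈ Subgroup.closure {M.next, M.flip}, g d = e) ∧
  (Nat.card M.Vertex : ℤ) - Nat.card M.Edge + Nat.card M.Tile = 2

/-- Every tile is a pentagon with five different vertices. -/
def AllPentagons {D : Type*} (M : OrientedMap D) : Prop :=
  ∀ d, (M.next ^ 5) d = d ∧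
    Function.Injective (fun i : Fin 5 => M.vertexOf ((M.next ^ (i : ℕ)) d))

/-- `N(v)`: the set of all tiles touching the vertex `v`. -/
def nbhd {D : Type*} (M : OrientedMap D) (v : M.Vertex) : Set M.Tile :=
  {t | ∃ d, M.vertexOf d = v ∧ M.tileOf d = t}

end OrientedMap

/-- An oriented map together with a symbol at every corner of every tile. -/
structure CornerMap (D : Type*) extends OrientedMap D where
  corner : D → Corner

namespace CornerMap

/-- The combination of corners at a vertex. -/
def cornersAt {D : Type*} [Finite D] (T : CornerMap D) (v : T.Vertex) : Multiset Corner :=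
  (Set.toFinite {d | T.vertexOf d = v}).toFinset.val.map T.corner

/-- Every tile has its corners arranged as `p` in cyclic order, counterclockwise or clockwise. -/
def HasArrangement {D : Type*} (T : CornerMap D) (p : ZMod 5 → Corner) : Prop :=
  ∀ d, (∃ k : ZMod 5, ∀ i : ℕ, T.corner ((T.next ^ i) d) = p (k + i)) ∨
    (∃ k : ZMod 5, ∀ i : ℕ, T.corner ((T.next ^ i) d) = p (k - i))

end CornerMap

/-- The data of an anglewise vertex combination: the number of tiles, the corners of the pentagon,
and how many times each combination of corners occurs as a vertex. -/
structure AVC where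
  tiles : ℕ
  pentagon : Multiset Corner
  vertices : Multiset Corner → ℕ

open Corner in
/-- `{24 α²βγδ : 24 αβγ, 8 α³, 6 δ⁴}` -/
def avc4D24 : AVC where
  tiles := 24
  pentagon := {α, α, β, γ, δ}
  vertices := Pi.single {α, β, γ} 24 + Pi.single {α, α, α} 8 + Pi.single {δ, δ, δ, δ} 6

open Corner in
/-- `{60 α²βγδ : 60 αβγ, 20 α³, 12 δ⁵}` -/
def avc4D60 : AVC where
  tiles := 60
  pentagon := {α, α, β, γ, δ}
  vertices := Pi.single {α, β, γ} 60 + Pi.single {α, α, α} 20 + Pi.single {δ, δ, δ, δ, δ} 12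

namespace CornerMap

/-- `T` is an edge-to-edge tiling of the sphere by corner congruent pentagons, with the given
anglewise vertex combination. -/
structure IsTilingFor {D : Type*} [Finite D] (T : CornerMap D) (A : AVC) : Prop where
  sphere : T.IsSphere
  pentagons : T.AllPentagons
  card_tiles : Nat.card T.Tile = A.tiles
  congruent : ∃ p : ZMod 5 → Corner, Finset.univ.val.map p = A.pentagon ∧ T.HasArrangement p
  vertices : ∀ m : Multiset Corner, Nat.card {v : T.Vertex // T.cornersAt v = m} = A.vertices m

/-- Change of the symbols. -/
def relabel {D : Type*} (T : CornerMap D) (f : Corner → Corner) : CornerMap D where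
  toOrientedMap := T.toOrientedMap
  corner d := f (T.corner d)

/-- Exchange of `β` and `γ` in all tiles. -/
def exchange {D : Type*} (T : CornerMap D) : CornerMap D :=
  T.relabel (Equiv.swap Corner.β Corner.γ)

/-- The mirror image. Tiles are now traversed in the opposite sense, so that the side `d` starts at
the point where it used to end, which is the corner formerly denoted by `next d`. -/
def mirror {D : Type*} (T : CornerMap D) : CornerMap D where
  next := T.next⁻¹
  flip := T.flip
  flip_flip := T.flip_flip
  flip_ne := T.flip_ne
  corner d := T.corner (T.next d)

/-- Orientation preserving isomorphism, respecting the symbols at the corners. -/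
def Iso {D D' : Type*} (T : CornerMap D) (U : CornerMap D') : Prop :=
  ∃ e : D ≃ D', (∀ d, e (T.next d) = U.next (e d)) ∧ (∀ d, e (T.flip d) = U.flip (e d)) ∧
    ∀ d, U.corner (e d) = T.corner d

/-- `T` and `U` are the same tiling up to a homeomorphism of the sphere, which may reverse the
orientation. -/
def SameTiling {D D' : Type*} (T : CornerMap D) (U : CornerMap D') : Prop :=
  T.Iso U ∨ T.Iso U.mirror

open Classical in
/-- For a set `S` of vertices, change the orientation of every `N(v)`, `v ∈ S`: in the tiles of
`N(v)`, the direction `β → γ` is reversed by exchanging `β` and `γ`. -/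
def reorient {D : Type*} (T : CornerMap D) (S : Set T.Vertex) : CornerMap D where
  toOrientedMap := T.toOrientedMap
  corner d := if ∃ v ∈ S, T.tileOf d ∈ T.nbhd v then Equiv.swap Corner.β Corner.γ (T.corner d)
    else T.corner d

end CornerMap

/-- The corners of the tiles of a pentagonal subdivision, see `pentSubdivision`. -/
def subdivisionCorner : Fin 5 → Corner := ![.ε, .α, .δ, .β, .γ]

/-- The pentagonal subdivision of `M`, with the standard five symbols at the corners.
Every edge of `M` is divided into three parts by two new points; for a side `d` of a tile they are
called, along the direction of `d`, `p d` and `q d` (so that `q d = p (flip d)`). Every tile of `M`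
gets a new point `c` in the middle, which is joined to the points `q d` for all sides `d` of
the tile. So there is one pentagon for every `d`; its corners are, counterclockwise,
`c`, `q (next⁻¹ d)`, the starting point of `d`, `p d`, `q d`,
with the symbols `ε`, `α`, `δ`, `β`, `γ`. The side number `k` of this pentagon, from its corner
number `k` to its corner number `k + 1`, is `(d, k)`. -/
def pentSubdivision {D : Type*} (M : OrientedMap D) : CornerMap (D × Fin 5) where
  next := (Equiv.refl D).prodCongr (Equiv.addRight 1)
  flip := Function.Involutive.toPerm
    (fun x => match x with
      | (d, 0) => (M.next⁻¹ d, 4)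
      | (d, 1) => (M.flip (M.next⁻¹ d), 2)
      | (d, 2) => (M.next (M.flip d), 1)
      | (d, 3) => (M.flip d, 3)
      | (d, 4) => (M.next d, 0))
    (by
      rintro ⟨d, k⟩
      fin_cases k <;> simp [M.flip_flip])
  flip_flip := by
    rintro ⟨d, k⟩
    fin_cases k <;> simp [M.flip_flip]
  flip_ne := by
    rintro ⟨d, k⟩
    fin_cases k <;> simp [M.flip_ne]
  corner x := subdivisionCorner x.2

open Corner in
/-- `4D₁` (`α = δ`): `α, β, γ, δ, ε → α, γ, β, α, δ`. -/
def label4D1 : Corner → Corner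
  | α => α
  | β => γ
  | γ => β
  | δ => α
  | ε => δ

open Corner in
/-- `4D₂` (`β = δ`): `α, β, γ, δ, ε → β, α, γ, α, δ`. -/
def label4D2 : Corner → Corner
  | α => β
  | β => α
  | γ => γ
  | δ => α
  | ε => δ

open Corner in
/-- `4D₃` (`γ = δ`): `α, β, γ, δ, ε → β, γ, α, α, δ`. -/
def label4D3 : Corner → Corner
  | α => β
  | β => γ
  | γ => α
  | δ => α
  | ε => δ

/-- The oriented map of a polyhedron given by the lists `F` of the vertices of its faces
(counterclockwise, seen from outside). The side `(f, i)` goes from `F f i` to `F f (i + 1)`, and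
`G f i` is the side with the same end points and the opposite direction. -/
def ofFaces {n k m : ℕ} [NeZero k] (F : Fin n → Fin k → Fin m) (G : Fin n → Fin k → Fin n × Fin k)
    (_hF : ∀ f i, F (G f i).1 (G f i).2 = F f (i + 1) ∧ F (G f i).1 ((G f i).2 + 1) = F f i)
    (h : ∀ f i, G (G f i).1 (G f i).2 = (f, i)) (h' : ∀ f i, G f i ≠ (f, i)) :
    OrientedMap (Fin n × Fin k) where
  next := (Equiv.refl _).prodCongr (Equiv.addRight 1)
  flip := Function.Involutive.toPerm (fun d => G d.1 d.2) (fun d => h d.1 d.2)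
  flip_flip d := h d.1 d.2
  flip_ne d := h' d.1 d.2

/-- The faces of the cube: top, four sides, bottom. -/
def cubeFaces : Fin 6 → Fin 4 → Fin 8 :=
  ![![0, 1, 2, 3],
    ![1, 0, 4, 5], ![2, 1, 5, 6], ![3, 2, 6, 7], ![0, 3, 7, 4],
    ![7, 6, 5, 4]]

/-- The faces of the dodecahedron: top, five upper faces, five lower faces, bottom. -/
def dodecahedronFaces : Fin 12 → Fin 5 → Fin 20 :=
  ![![0, 1, 2, 3, 4],
    ![1, 0, 5, 10, 6], ![2, 1, 6, 11, 7], ![3, 2, 7, 12, 8], ![4, 3, 8, 13, 9], ![0, 4, 9, 14, 5],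
    ![6, 10, 15, 16, 11], ![7, 11, 16, 17, 12], ![8, 12, 17, 18, 13], ![9, 13, 18, 19, 14],
    ![5, 14, 19, 15, 10],
    ![19, 18, 17, 16, 15]]

/-- The sides opposite to those of the faces of the cube. -/
def cubeSides : Fin 6 → Fin 4 → Fin 6 × Fin 4 :=
  ![![(1, 0), (2, 0), (3, 0), (4, 0)],
    ![(0, 0), (4, 3), (5, 2), (2, 1)],
    ![(0, 1), (1, 3), (5, 1), (3, 1)],
    ![(0, 2), (2, 3), (5, 0), (4, 1)],
    ![(0, 3), (3, 3), (5, 3), (1, 1)],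
    ![(3, 2), (2, 2), (1, 2), (4, 2)]]

/-- The sides opposite to those of the faces of the dodecahedron. -/
def dodecahedronSides : Fin 12 → Fin 5 → Fin 12 × Fin 5 :=
  ![![(1, 0), (2, 0), (3, 0), (4, 0), (5, 0)],
    ![(0, 0), (5, 4), (10, 4), (6, 0), (2, 1)],
    ![(0, 1), (1, 4), (6, 4), (7, 0), (3, 1)],
    ![(0, 2), (2, 4), (7, 4), (8, 0), (4, 1)],
    ![(0, 3), (3, 4), (8, 4), (9, 0), (5, 1)],
    ![(0, 4), (4, 4), (9, 4), (10, 0), (1, 1)],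
    ![(1, 3), (10, 3), (11, 3), (7, 1), (2, 2)],
    ![(2, 3), (6, 3), (11, 2), (8, 1), (3, 2)],
    ![(3, 3), (7, 3), (11, 1), (9, 1), (4, 2)],
    ![(4, 3), (8, 3), (11, 0), (10, 1), (5, 2)],
    ![(5, 3), (9, 3), (11, 4), (6, 1), (1, 2)],
    ![(9, 2), (8, 2), (7, 2), (6, 2), (10, 2)]]

set_option maxRecDepth 100000 in
/-- The cube `P₆`. -/
def cube : OrientedMap (Fin 6 × Fin 4) :=
  ofFaces cubeFaces cubeSides (by decide) (by decide) (by decide)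

set_option maxRecDepth 100000 in
/-- The dodecahedron `P₁₂`. -/
def dodecahedron : OrientedMap (Fin 12 × Fin 5) :=
  ofFaces dodecahedronFaces dodecahedronSides (by decide) (by decide) (by decide)

/-- The pentagonal subdivisions `PP₆` and `PP₁₂`. -/
def PP6 : CornerMap ((Fin 6 × Fin 4) × Fin 5) := pentSubdivision cube

def PP12 : CornerMap ((Fin 12 × Fin 5) × Fin 5) := pentSubdivision dodecahedron

end PentTiling

end

universe v w

namespace PentTiling
open Corner


/-! Forget `α`, `β`, `γ` and keep only `δ`. Each tile has one `δ`, the vertices with a `δ` are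
exactly the `δᵏ` (`k = 4, 5`), and all others have degree 3 (`IsDeltaPattern`). Number the corners
and sides of a tile counterclockwise from its `δ`. Side 0 is always glued to a side 4. At the far
end of such an edge the third tile fits in only two ways (`side_cases`), which are mirror images of
each other. The second way spreads around a `δᵏ` and on to the neighbours, so a connected tiling has
one handedness (`all_first_or_all_second`). Up to reflection the gluings are 0–4, 1–2, 3–3, those of
a pentagonal subdivision.

The tiles then act as the sides of a coarser map with `k`-gonal faces and vertices of degree 3:
`rotate` is its `next`, `turn` its `flip`. The cube and the dodecahedron map to any such structure
(`IsUniversal`), and the number of tiles makes the induced map of subdivisions an isomorphism.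

It remains to place the symbols. Corners number 2 meet in threes and take only two values, so they
are all `α`. If only one of the two middle positions of the arrangement is `α`, every tile is read
the same way, which gives `4D₁`, `4D₃` and their exchanges. If both are, each tile may have `β` and
`γ` exchanged, and the `αβγ` vertices force the same choice around every `δᵏ`: these are the
modifications of `4D₂` (`corner_cases`). Conversely, all these labellings of the subdivision are
checked by counting (`labelledSubdivision_isTilingFor`). -/

/-! ### Orbits of permutations, connectedness, counting by fibers -/

/-- If `σ ^ m` fixes `a`, the cycle of `a` consists of the first `m` iterates. -/
theorem exists_pow_lt_of_sameCycle {D : Type*} {σ : Equiv.Perm D} {m : ℕ} (hm : 0 < m) {a b : D}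
    (h : (σ ^ m) a = a) (hab : σ.SameCycle a b) : ∃ j < m, (σ ^ j) a = b := by
  obtain ⟨i, rfl⟩ := hab
  have hm' : (m : ℤ) ≠ 0 := by exact_mod_cast hm.ne'
  refine ⟨(i % m).toNat, ?_, ?_⟩
  · have := Int.emod_lt_of_pos i (by exact_mod_cast hm : (0 : ℤ) < m)
    have := Int.emod_nonneg i hm'
    omega
  · have h0 := Int.emod_nonneg i hm'
    have h1 : ((σ ^ (m : ℤ)) ^ (i / m)) a = a :=
      Function.IsFixedPt.perm_zpow (e := σ ^ (m : ℤ)) h _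
    conv_rhs => rw [← Int.emod_add_mul_ediv i m, zpow_add, Equiv.Perm.mul_apply, zpow_mul, h1]
    rw [← zpow_natCast, Int.toNat_of_nonneg h0]

/-- Finiteness makes every point of the cycle a nonnegative iterate, so invariance in the forward
direction suffices. -/
theorem iff_of_sameCycle {D : Type*} [Finite D] {σ : Equiv.Perm D} {P : D → Prop}
    (h : ∀ d, P d → P (σ d)) {a b : D} (hab : σ.SameCycle a b) : P a ↔ P b := by
  have key : ∀ a b, σ.SameCycle a b → P a → P b := by
    intro a b hab ha
    obtain ⟨j, rfl⟩ := hab.exists_nat_pow_eq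
    clear hab
    induction j with
    | zero => simpa
    | succ j ih => rw [pow_succ', Equiv.Perm.mul_apply]; exact h _ ih
  exact ⟨key a b hab, key b a hab.symm⟩

namespace OrientedMap

variable {D : Type*} (M : OrientedMap D)

theorem vertexOf_eq {a b : D} : M.vertexOf a = M.vertexOf b ↔ M.around.SameCycle a b :=
  Quotient.eq (r := Equiv.Perm.SameCycle.setoid M.around)

theorem tileOf_eq {a b : D} : M.tileOf a = M.tileOf b ↔ M.next.SameCycle a b :=
  Quotient.eq (r := Equiv.Perm.SameCycle.setoid M.next)

theorem vertexOf_surjective : Function.Surjective M.vertexOf := Quotient.mk_surjective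

theorem tileOf_surjective : Function.Surjective M.tileOf := Quotient.mk_surjective

instance [Finite D] : Finite M.Vertex := Quotient.finite _
instance [Finite D] : Finite M.Tile := Quotient.finite _
instance [Finite D] : Finite M.Edge := Quotient.finite _

theorem around_apply (d : D) : M.around d = M.flip (M.next⁻¹ d) := rfl

theorem around_next (d : D) : M.around (M.next d) = M.flip d := by simp [around_apply]

theorem around_inv_apply (d : D) : M.around⁻¹ d = M.next (M.flip d) := by
  rw [Equiv.Perm.inv_eq_iff_eq, around_next, M.flip_flip]

theorem vertexOf_around (d : D) : M.vertexOf (M.around d) = M.vertexOf d :=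
  M.vertexOf_eq.2 (Equiv.Perm.sameCycle_apply_left.2 (Equiv.Perm.SameCycle.refl _ _))

/-- A property that is invariant under `next` and `flip` holds everywhere on a connected map as
soon as it holds somewhere. -/
theorem forall_of_connected [Finite D]
    (hM : ∀ d e : D, ∃ g ∈ Subgroup.closure {M.next, M.flip}, g d = e) {P : D → Prop}
    (hn : ∀ d, P d → P (M.next d)) (hf : ∀ d, P d → P (M.flip d)) {a : D} (ha : P a) (d : D) :
    P d := by
  obtain ⟨g, hg, rfl⟩ := hM a d
  have key : ∀ g ∈ Subgroup.closure {M.next, M.flip}, ∀ d, P d ↔ P (g d) := by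
    intro g hg
    induction hg using Subgroup.closure_induction with
    | mem x hx =>
      intro d
      rcases hx with rfl | rfl
      · exact iff_of_sameCycle hn
          (Equiv.Perm.sameCycle_apply_right.2 (Equiv.Perm.SameCycle.refl _ _))
      · exact iff_of_sameCycle hf
          (Equiv.Perm.sameCycle_apply_right.2 (Equiv.Perm.SameCycle.refl _ _))
    | one => simp
    | mul x y _ _ hx hy => intro d; rw [hy, hx]; rfl
    | inv x _ hx => intro d; rw [hx (x⁻¹ d)]; simp
  exact (key g hg a).1 ha

/-- Connectedness can be checked with properties that are invariant under `next` and `flip`. -/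
theorem connected_of_induction (a : D)
    (h : ∀ P : D → Prop, (∀ d, P d → P (M.next d)) → (∀ d, P d → P (M.flip d)) → P a → ∀ d, P d)
    (d e : D) : ∃ g ∈ Subgroup.closure {M.next, M.flip}, g d = e := by
  have key := h (fun d => ∃ g ∈ Subgroup.closure {M.next, M.flip}, g a = d)
    (fun d ⟨g, hg, hd⟩ => ⟨M.next * g, mul_mem (Subgroup.subset_closure (by simp)) hg, by simp [hd]⟩)
    (fun d ⟨g, hg, hd⟩ => ⟨M.flip * g, mul_mem (Subgroup.subset_closure (by simp)) hg, by simp [hd]⟩)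
    ⟨1, one_mem _, rfl⟩
  obtain ⟨g, hg, rfl⟩ := key d
  obtain ⟨g', hg', rfl⟩ := key e
  exact ⟨g' * g⁻¹, mul_mem hg' (inv_mem hg), by simp⟩

end OrientedMap

/-- The fibers of a map to a finite type, all of the same size, counted together. -/
theorem card_fiber_mul {D V : Type*} [Finite D] [Finite V] (q : D → V) (P : V → Prop) (m : ℕ)
    (h : ∀ v, P v → Nat.card {d // q d = v} = m) :
    m * Nat.card {v // P v} = Nat.card {d // P (q d)} := by
  classical
  have := Fintype.ofFinite {v // P v}
  let e : {d // P (q d)} ≃ Σ v : {v // P v}, {d // q d = v.1} :=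
    { toFun := fun d => ⟨⟨q d.1, d.2⟩, ⟨d.1, rfl⟩⟩
      invFun := fun x => ⟨x.2.1, by rw [x.2.2]; exact x.1.2⟩
      left_inv := fun _ => rfl
      right_inv := by
        rintro ⟨⟨v, hv⟩, ⟨d, hd⟩⟩
        change q d = v at hd
        subst hd
        rfl }
  rw [Nat.card_congr e, Nat.card_sigma, Finset.sum_congr rfl (fun v _ => h v.1 v.2)]
  simp [Nat.card_eq_fintype_card, mul_comm]

theorem card_fiber_mul_card {D V : Type*} [Finite D] [Finite V] (q : D → V) (m : ℕ)
    (h : ∀ v, Nat.card {d // q d = v} = m) : m * Nat.card V = Nat.card D := by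
  have := card_fiber_mul q (fun _ => True) m (fun v _ => h v)
  rwa [Nat.card_congr (Equiv.subtypeUnivEquiv fun _ => trivial),
    Nat.card_congr (Equiv.subtypeUnivEquiv fun _ => trivial)] at this

/-- The cycle of a point of exact period `m` has `m` elements. -/
theorem card_sameCycle {D : Type*} {σ : Equiv.Perm D} {m : ℕ} (hm : 0 < m) {d : D}
    (h : (σ ^ m) d = d) (h' : ∀ j, 0 < j → j < m → (σ ^ j) d ≠ d) :
    Set.InjOn (fun j => (σ ^ j) d) (Finset.range m : Set ℕ) ∧
    {e | σ.SameCycle e d} = (fun j => (σ ^ j) d) '' (Finset.range m : Set ℕ) := by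
  constructor
  · have key : ∀ i j, i < j → j < m → (σ ^ i) d ≠ (σ ^ j) d := by
      intro i j hij hj he
      apply h' (j - i) (by omega) (by omega)
      apply (σ ^ i).injective
      rw [← Equiv.Perm.mul_apply, ← pow_add, he]
      congr 2; omega
    intro i hi j hj hij
    simp only [Finset.coe_range, Set.mem_Iio] at hi hj
    rcases lt_trichotomy i j with hlt | rfl | hlt
    · exact absurd hij (key i j hlt hj)
    · rfl
    · exact absurd hij.symm (key j i hlt hi)
  · ext e
    simp only [Set.mem_ofPred_eq, Finset.coe_range, Set.mem_image, Set.mem_Iio]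
    constructor
    · intro he
      exact exists_pow_lt_of_sameCycle hm h he.symm
    · rintro ⟨j, _, rfl⟩
      exact Equiv.Perm.sameCycle_pow_left.2 (Equiv.Perm.SameCycle.refl _ _)

theorem natCard_sameCycle {D : Type*} {σ : Equiv.Perm D} {m : ℕ} (hm : 0 < m) {d : D}
    (h : (σ ^ m) d = d) (h' : ∀ j, 0 < j → j < m → (σ ^ j) d ≠ d) :
    Nat.card {e // σ.SameCycle e d} = m := by
  obtain ⟨hi, hs⟩ := card_sameCycle hm h h'
  change Nat.card ({e | σ.SameCycle e d} : Set D) = m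
  rw [hs, Nat.card_image_of_injOn hi]
  simp

/-! ### The corners at a vertex -/

namespace CornerMap

variable {D : Type*} [Finite D] (T : CornerMap D)

theorem card_cornersAt (v : T.Vertex) :
    (T.cornersAt v).card = Nat.card {d // T.vertexOf d = v} := by
  simp only [cornersAt, Multiset.card_map, Finset.card_val]
  exact (Nat.card_eq_card_finite_toFinset _).symm

theorem cornersAt_vertexOf_eq {m : ℕ} (hm : 0 < m) {d : D}
    (h : (T.around ^ m) d = d) (h' : ∀ j, 0 < j → j < m → (T.around ^ j) d ≠ d) :
    T.cornersAt (T.vertexOf d) = (Multiset.range m).map fun j => T.corner ((T.around ^ j) d) := by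
  classical
  obtain ⟨hi, hs⟩ := card_sameCycle hm h h'
  have : (Set.toFinite {e | T.vertexOf e = T.vertexOf d}).toFinset =
      (Finset.range m).image fun j => (T.around ^ j) d := by
    apply Finset.coe_injective
    simp only [T.vertexOf_eq, Set.Finite.coe_toFinset, Finset.coe_image]
    exact hs
  rw [cornersAt, this, Finset.image_val_of_injOn hi, Multiset.map_map]
  rfl

/-- The degree is the minimal period of `around` at `d`, so it can be read off from the combination
of corners. -/
theorem cornersAt_vertexOf (d : D) : (T.around ^ (T.cornersAt (T.vertexOf d)).card) d = d ∧
    T.cornersAt (T.vertexOf d) = (Multiset.range (T.cornersAt (T.vertexOf d)).card).map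
      fun j => T.corner ((T.around ^ j) d) := by
  have hm : 0 < Function.minimalPeriod T.around d := by
    apply Function.minimalPeriod_pos_of_mem_periodicPts
    exact ⟨orderOf T.around, orderOf_pos _, by
      rw [Function.IsPeriodicPt, Function.IsFixedPt, Equiv.Perm.iterate_eq_pow, pow_orderOf_eq_one]
      rfl⟩
  have h : (T.around ^ Function.minimalPeriod T.around d) d = d := by
    rw [← Equiv.Perm.iterate_eq_pow]; exact Function.isPeriodicPt_minimalPeriod _ _
  have h' := T.cornersAt_vertexOf_eq hm h (by
    intro j hj hj' he
    rw [← Equiv.Perm.iterate_eq_pow] at he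
    exact Function.not_isPeriodicPt_of_pos_of_lt_minimalPeriod hj.ne' hj' he)
  have hc : (T.cornersAt (T.vertexOf d)).card = Function.minimalPeriod T.around d := by
    rw [h']; simp
  rw [hc]
  exact ⟨h, h'⟩

theorem corner_mem_cornersAt (d : D) : T.corner d ∈ T.cornersAt (T.vertexOf d) := by
  rw [cornersAt, Multiset.mem_map]
  exact ⟨d, by simp, rfl⟩

/-- Replaces counting vertices by counting corners, which are explicit in a subdivision. -/
theorem card_mul_card_cornersAt (m : Multiset Corner) :
    m.card * Nat.card {v // T.cornersAt v = m} =
      Nat.card {d // T.cornersAt (T.vertexOf d) = m} :=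
  card_fiber_mul T.vertexOf (fun v => T.cornersAt v = m) _ (by
    rintro v rfl; exact (T.card_cornersAt v).symm)

end CornerMap


/-! ### One family of vertex combinations; invariance under isomorphism, reflection and exchange -/

/-- `{N α²βγδ : N αβγ, b α³, g δᵏ}` -/
def avcDelta (k N b g : ℕ) : AVC where
  tiles := N
  pentagon := {α, α, β, γ, δ}
  vertices := Pi.single {α, β, γ} N + Pi.single {α, α, α} b + Pi.single (Multiset.replicate k δ) g

theorem avc4D24_eq : avc4D24 = avcDelta 4 24 8 6 := rfl

theorem avc4D60_eq : avc4D60 = avcDelta 5 60 20 12 := rfl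

theorem sameCycle_iff_of_semiconj {D D' : Type*} [Finite D] [Finite D'] (e : D ≃ D')
    {σ : Equiv.Perm D} {τ : Equiv.Perm D'} (h : ∀ d, e (σ d) = τ (e d)) {a b : D} :
    σ.SameCycle a b ↔ τ.SameCycle (e a) (e b) := by
  constructor
  · intro hab
    refine (iff_of_sameCycle (P := fun x => τ.SameCycle (e a) (e x)) ?_ hab).1
      (Equiv.Perm.SameCycle.refl _ _)
    intro d hd
    rw [h]
    exact Equiv.Perm.sameCycle_apply_right.2 hd
  · intro hab
    have := (iff_of_sameCycle (P := fun x => σ.SameCycle a (e.symm x)) ?_ hab).1 (by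
      simpa using Equiv.Perm.SameCycle.refl _ _)
    · simpa using this
    intro d hd
    have : e.symm (τ d) = σ (e.symm d) := by rw [Equiv.symm_apply_eq, h]; simp
    rw [this]
    exact Equiv.Perm.sameCycle_apply_right.2 hd

theorem OrientedMap.allPentagons_iff {D : Type*} (M : OrientedMap D) :
    M.AllPentagons ↔ (∀ d, (M.next ^ 5) d = d) ∧
      ∀ d i, 0 < i → i < 5 → M.vertexOf ((M.next ^ i) d) ≠ M.vertexOf d := by
  constructor
  · intro h
    refine ⟨fun d => (h d).1, fun d i hi hi' he => ?_⟩
    have := @(h d).2 ⟨i, hi'⟩ ⟨0, by omega⟩ (by simpa using he)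
    simp only [Fin.mk.injEq] at this
    omega
  · rintro ⟨h5, h⟩ d
    refine ⟨h5 d, ?_⟩
    have key : ∀ i j : ℕ, i < j → j < 5 →
        M.vertexOf ((M.next ^ i) d) ≠ M.vertexOf ((M.next ^ j) d) := by
      intro i j hij hj he
      apply h ((M.next ^ i) d) (j - i) (by omega) (by omega)
      rw [he, ← Equiv.Perm.mul_apply, ← pow_add]
      congr 3; omega
    intro i j hij
    rcases lt_trichotomy i j with hlt | rfl | hlt
    · exact absurd hij (key i j hlt j.2)
    · rfl
    · exact absurd hij.symm (key j i hlt i.2)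

namespace CornerMap

section transport
variable {D D' : Type*} [Finite D] [Finite D'] {T : CornerMap D} {U : CornerMap D'}

theorem cornersAt_congr (e : D ≃ D')
    (hv : ∀ a b, T.around.SameCycle a b ↔ U.around.SameCycle (e a) (e b))
    (hc : ∀ d, T.corner d = U.corner (e d)) (d : D) :
    T.cornersAt (T.vertexOf d) = U.cornersAt (U.vertexOf (e d)) := by
  classical
  have : (Set.toFinite {x | U.vertexOf x = U.vertexOf (e d)}).toFinset =
      (Set.toFinite {x | T.vertexOf x = T.vertexOf d}).toFinset.map e.toEmbedding := by
    ext x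
    obtain ⟨y, rfl⟩ := e.surjective x
    simp [OrientedMap.vertexOf_eq, hv]
  rw [cornersAt, cornersAt, this, Finset.map_val, Multiset.map_map]
  exact Multiset.map_congr rfl fun x _ => hc x

theorem natCard_vertices_congr (e : D ≃ D')
    (hv : ∀ a b, T.around.SameCycle a b ↔ U.around.SameCycle (e a) (e b))
    (hc : ∀ d, T.corner d = U.corner (e d)) :
    Nat.card T.Vertex = Nat.card U.Vertex ∧
    ∀ m, Nat.card {v // T.cornersAt v = m} = Nat.card {v // U.cornersAt v = m} := by
  let E : T.Vertex ≃ U.Vertex := Quotient.congr e hv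
  refine ⟨Nat.card_congr E, fun m => Nat.card_congr (E.subtypeEquiv fun v => ?_)⟩
  obtain ⟨d, rfl⟩ := T.vertexOf_surjective v
  rw [cornersAt_congr e hv hc]
  rfl

/-- Only orbits are compared, not the permutations themselves, so that a reflection, which inverts
the cyclic orders, is covered as well. -/
theorem IsTilingFor.of_equiv {A : AVC} (hU : U.IsTilingFor A) (e : D ≃ D')
    (hv : ∀ a b, T.around.SameCycle a b ↔ U.around.SameCycle (e a) (e b))
    (hc : ∀ d, T.corner d = U.corner (e d))
    (ht : ∀ a b, T.next.SameCycle a b ↔ U.next.SameCycle (e a) (e b))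
    (he : Nat.card T.Edge = Nat.card U.Edge)
    (hconn : ∀ d e : D, ∃ g ∈ Subgroup.closure {T.next, T.flip}, g d = e)
    (hp : T.AllPentagons) (ha : ∀ p, U.HasArrangement p → T.HasArrangement p) :
    T.IsTilingFor A := by
  obtain ⟨hV, hm⟩ := natCard_vertices_congr e hv hc
  have hT : Nat.card T.Tile = Nat.card U.Tile :=
    Nat.card_congr (show T.Tile ≃ U.Tile from Quotient.congr e ht)
  refine ⟨⟨hconn, ?_⟩, hp, hT.trans hU.card_tiles, ?_, fun m => (hm m).trans (hU.vertices m)⟩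
  · rw [hV, he, hT]
    exact hU.sphere.2
  · obtain ⟨p, h, h'⟩ := hU.congruent
    exact ⟨p, h, ha p h'⟩

theorem IsTilingFor.of_iso {A : AVC} (hU : U.IsTilingFor A) (h : T.Iso U) : T.IsTilingFor A := by
  obtain ⟨e, hn, hf, hc⟩ := h
  have hn' : ∀ d, e (T.next⁻¹ d) = U.next⁻¹ (e d) := by
    intro d
    rw [Equiv.Perm.eq_inv_iff_eq, ← hn]; simp
  have hv : ∀ a b, T.around.SameCycle a b ↔ U.around.SameCycle (e a) (e b) := fun a b =>
    sameCycle_iff_of_semiconj e fun d => by simp only [OrientedMap.around_apply, hf, hn']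
  have hpow : ∀ i d, e ((T.next ^ i) d) = (U.next ^ i) (e d) := by
    intro i
    induction i with
    | zero => simp
    | succ i ih => intro d; rw [pow_succ, pow_succ, Equiv.Perm.mul_apply, ih, hn]; rfl
  refine hU.of_equiv e hv (fun d => (hc d).symm) (fun a b => sameCycle_iff_of_semiconj e hn)
    (Nat.card_congr (Quotient.congr e fun a b => sameCycle_iff_of_semiconj e hf)) ?_ ?_ ?_
  · intro a b
    refine T.connected_of_induction a ?_ a b
    intro P h1 h2 h3 d
    have := U.forall_of_connected hU.sphere.1 (P := fun x => P (e.symm x)) (a := e a)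
      (fun x hx => ?_) (fun x hx => ?_) (by simpa using h3) (e d)
    · simpa using this
    · have : e.symm (U.next x) = T.next (e.symm x) := by rw [Equiv.symm_apply_eq, hn]; simp
      rw [this]; exact h1 _ hx
    · have : e.symm (U.flip x) = T.flip (e.symm x) := by rw [Equiv.symm_apply_eq, hf]; simp
      rw [this]; exact h2 _ hx
  · have := (U.allPentagons_iff).1 hU.pentagons
    rw [OrientedMap.allPentagons_iff]
    refine ⟨fun d => e.injective (by rw [hpow, this.1]), fun d i h0 h5 hd => ?_⟩
    apply this.2 (e d) i h0 h5
    rw [OrientedMap.vertexOf_eq] at hd ⊢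
    rwa [← hpow, ← hv]
  · intro p hp d
    have := hp (e d)
    simpa only [← hpow, hc] using this

end transport

section mirror
theorem Iso.mirror_right {D D' : Type*} {T : CornerMap D} {U : CornerMap D'} (h : T.mirror.Iso U) :
    T.Iso U.mirror := by
  obtain ⟨e, hn, hf, hc⟩ := h
  have hn' : ∀ d, e (T.next d) = U.next⁻¹ (e d) := by
    intro d
    rw [Equiv.Perm.eq_inv_iff_eq, ← hn]
    simp [mirror]
  refine ⟨e, hn', hf, fun d => ?_⟩
  have := hc (T.next d)
  rw [hn'] at this
  have h2 := hc (T.next⁻¹ d)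
  have h3 : e (T.next⁻¹ d) = U.next (e d) := hn d
  rw [h3] at h2
  simpa [mirror] using h2

variable {D : Type*} [Finite D] {T : CornerMap D}

/-- The corner at `d` in the mirror image is the old corner at `next d`, so the bijection of corners
is `T.next`; it conjugates the new `around` to the inverse of the old one. -/
theorem IsTilingFor.mirror {A : AVC} (h : T.IsTilingFor A) : T.mirror.IsTilingFor A := by
  have hpent := (T.allPentagons_iff).1 h.pentagons
  have hv : ∀ a b, T.mirror.around.SameCycle a b ↔ T.around.SameCycle (T.next a) (T.next b) := by
    intro a b
    rw [← Equiv.Perm.sameCycle_inv (f := T.around)]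
    refine sameCycle_iff_of_semiconj T.next fun d => ?_
    rw [OrientedMap.around_inv_apply]
    simp [OrientedMap.around_apply, CornerMap.mirror]
  have hpow : ∀ (i : ℕ) (d : D), (T.mirror.next ^ i) d = (T.next ^ i)⁻¹ d := by
    intro i d
    change (T.next⁻¹ ^ i) d = _
    rw [inv_pow]
  have hcomm : ∀ (i : ℕ) (d : D), T.next ((T.next ^ i)⁻¹ d) = (T.next ^ i)⁻¹ (T.next d) := by
    intro i d
    rw [← Equiv.Perm.mul_apply, ← Equiv.Perm.mul_apply]
    congr 1
    exact ((Commute.refl T.next).pow_right i).inv_right.eq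
  refine h.of_equiv T.next hv (fun d => rfl) (fun a b => ?_) rfl (fun a b => ?_) ?_ ?_
  · rw [← Equiv.Perm.sameCycle_inv (f := T.next)]
    exact sameCycle_iff_of_semiconj T.next fun d => by simp [CornerMap.mirror]
  · obtain ⟨g, hg, h'⟩ := h.sphere.1 a b
    refine ⟨g, ?_, h'⟩
    have : Subgroup.closure {T.next, T.flip} ≤
        Subgroup.closure {T.mirror.next, T.mirror.flip} := by
      rw [Subgroup.closure_le]
      rintro x (rfl | rfl)
      · rw [SetLike.mem_coe, ← inv_mem_iff]
        exact Subgroup.subset_closure (by simp [CornerMap.mirror])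
      · exact Subgroup.subset_closure (by simp [CornerMap.mirror])
    exact this hg
  · rw [OrientedMap.allPentagons_iff]
    constructor
    · intro d
      rw [hpow, Equiv.Perm.inv_eq_iff_eq, hpent.1]
    · intro d i h0 h5 he
      rw [OrientedMap.vertexOf_eq, hv, hpow, hcomm, ← OrientedMap.vertexOf_eq] at he
      apply hpent.2 ((T.next ^ i)⁻¹ (T.next d)) i h0 h5
      rw [he]; simp
  · intro p hp d
    -- In a pentagon `next⁻¹ = next ^ 4`, and `4 = -1` modulo 5: the two directions of reading are
    -- interchanged.
    have h4 : ∀ i : ℕ, T.mirror.corner ((T.mirror.next ^ i) d) =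
        T.corner ((T.next ^ (4 * i + 1)) d) := by
      intro i
      rw [hpow]
      change T.corner (T.next _) = _
      congr 1
      rw [hcomm, Equiv.Perm.inv_eq_iff_eq, ← Equiv.Perm.mul_apply, ← pow_add,
        show i + (4 * i + 1) = 5 * i + 1 by ring, pow_succ, Equiv.Perm.mul_apply, pow_mul]
      exact (Function.IsFixedPt.perm_pow (hpent.1 _) i).symm
    have h5 : ∀ i : ℕ, ((4 * i + 1 : ℕ) : ZMod 5) = 1 - i := by
      intro i
      push_cast
      rw [show (4 : ZMod 5) = -1 from rfl]; ring
    rcases hp d with ⟨k, hk⟩ | ⟨k, hk⟩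
    · right
      refine ⟨k + 1, fun i => ?_⟩
      rw [h4, hk, h5]; ring_nf
    · left
      refine ⟨k - 1, fun i => ?_⟩
      rw [h4, hk, h5]; ring_nf

theorem cornersAt_relabel (T : CornerMap D) (f : Corner → Corner) (v : T.Vertex) :
    (T.relabel f).cornersAt v = (T.cornersAt v).map f := by
  simp only [cornersAt, Multiset.map_map]
  rfl

theorem map_swap_eq_iff (m m' : Multiset Corner) :
    m.map (Equiv.swap β γ) = m' ↔ m = m'.map (Equiv.swap β γ) := by
  constructor <;> rintro rfl <;> simp [Multiset.map_map]

/-- The pentagon and each of the three vertex combinations are symmetric in `β` and `γ`. -/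
theorem IsTilingFor.exchange {k N b g : ℕ} (h : T.IsTilingFor (avcDelta k N b g)) :
    T.exchange.IsTilingFor (avcDelta k N b g) := by
  refine ⟨h.sphere, h.pentagons, h.card_tiles, ?_, ?_⟩
  · obtain ⟨p, hp, hp'⟩ := h.congruent
    refine ⟨Equiv.swap β γ ∘ p, ?_, fun d => ?_⟩
    · rw [← Multiset.map_map, hp]
      change Multiset.map (Equiv.swap β γ) {α, α, β, γ, δ} = {α, α, β, γ, δ}
      decide
    · rcases hp' d with ⟨k, hk⟩ | ⟨k, hk⟩
      · exact .inl ⟨k, fun i => congrArg (Equiv.swap β γ) (hk i)⟩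
      · exact .inr ⟨k, fun i => congrArg (Equiv.swap β γ) (hk i)⟩
  · intro m
    have h1 : ∀ v, T.exchange.cornersAt v = m ↔ T.cornersAt v = m.map (Equiv.swap β γ) := by
      intro v
      rw [← map_swap_eq_iff]
      exact (cornersAt_relabel T (Equiv.swap β γ) v).symm ▸ Iff.rfl
    rw [Nat.card_congr (Equiv.subtypeEquivRight h1)]
    refine (h.vertices _).trans ?_
    have h2 : ∀ (m' : Multiset Corner) (c : ℕ), m'.map (Equiv.swap β γ) = m' →
        Pi.single (M := fun _ => ℕ) m' c (m.map (Equiv.swap β γ)) =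
          Pi.single (M := fun _ => ℕ) m' c m := by
      intro m' c hm'
      simp only [Pi.single_apply, map_swap_eq_iff, hm']
    simp only [avcDelta, Pi.add_apply]
    rw [h2, h2, h2]
    · rw [Multiset.map_replicate]; rfl
    · decide
    · decide

end mirror

theorem Iso.of_symm {D D' : Type*} {T : CornerMap D} {U : CornerMap D'} (h : U.Iso T) :
    T.Iso U := by
  obtain ⟨e, hn, hf, hc⟩ := h
  refine ⟨e.symm, fun d => ?_, fun d => ?_, fun d => ?_⟩
  · rw [Equiv.symm_apply_eq, hn]; simp
  · rw [Equiv.symm_apply_eq, hf]; simp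
  · rw [← hc]; simp

theorem IsTilingFor.of_sameTiling {D D' : Type*} [Finite D] [Finite D'] {T : CornerMap D}
    {U : CornerMap D'} {A : AVC} (hU : U.IsTilingFor A) (h : T.SameTiling U) :
    T.IsTilingFor A :=
  h.elim hU.of_iso hU.mirror.of_iso

end CornerMap


/-! ### Labelled pentagonal subdivisions are tilings -/

/-- A connected trivalent map all of whose tiles are `k`-gons. -/
structure OrientedMap.IsTrivalent {X : Type*} (M : OrientedMap X) (k : ℕ) : Prop where
  next_pow : ∀ x, (M.next ^ k) x = x
  next_pow_ne : ∀ x j, 0 < j → j < k → (M.next ^ j) x ≠ x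
  around_pow : ∀ x, (M.around ^ 3) x = x
  around_ne : ∀ x, M.around x ≠ x
  connected : ∀ d e, ∃ g ∈ Subgroup.closure {M.next, M.flip}, g d = e

/-- The pentagonal subdivision of `M` with arbitrary symbols at the corners. -/
def labelledSubdivision {X : Type*} (M : OrientedMap X) (c : X → Fin 5 → Corner) :
    CornerMap (X × Fin 5) where
  toOrientedMap := (pentSubdivision M).toOrientedMap
  corner d := c d.1 d.2

section subdivision
variable {X : Type*} (M : OrientedMap X) (c : X → Fin 5 → Corner)

local notation "𝒫" => labelledSubdivision M c

theorem subdivision_next (x : X) (i : Fin 5) : (𝒫).next (x, i) = (x, i + 1) := rfl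

theorem subdivision_next_pow (n : ℕ) (x : X) (i : Fin 5) :
    ((𝒫).next ^ n) (x, i) = (x, i + Fin.ofNat 5 n) := by
  induction n with
  | zero =>
    rw [Fin.ofNat_zero, add_zero]
    rfl
  | succ n ih =>
    rw [pow_succ', Equiv.Perm.mul_apply, ih, subdivision_next, add_assoc]
    congr 2
    exact (Nat.cast_succ (R := ZMod 5) n).symm

theorem subdivision_next_pow_five (x : X) (i : Fin 5) : ((𝒫).next ^ 5) (x, i) = (x, i) := by
  rw [subdivision_next_pow, Fin.ofNat_self, add_zero]

theorem not_add_ofNat_eq {i : Fin 5} {j : ℕ} (h0 : 0 < j) (h5 : j < 5) :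
    i + Fin.ofNat 5 j ≠ i := by
  rw [Ne, add_eq_left, Fin.ext_iff]
  simp only [Fin.ofNat, Fin.val_zero]
  omega

theorem subdivision_around (x : X) :
    (𝒫).around (x, 0) = (M.next x, 0) ∧ (𝒫).around (x, 1) = (M.next⁻¹ x, 4) ∧
    (𝒫).around (x, 2) = (M.around x, 2) ∧ (𝒫).around (x, 3) = (M.next (M.flip x), 1) ∧
    (𝒫).around (x, 4) = (M.flip x, 3) := by
  have h : ∀ (y : X) (i : Fin 5), (𝒫).around (y, i + 1) = (𝒫).flip (y, i) := fun y i =>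
    (𝒫).around_next (y, i)
  exact ⟨h x 4, h x 0, h x 1, h x 2, h x 3⟩

theorem subdivision_around_pow (n : ℕ) (x : X) :
    ((𝒫).around ^ n) (x, 0) = ((M.next ^ n) x, 0) ∧
    ((𝒫).around ^ n) (x, 2) = ((M.around ^ n) x, 2) := by
  induction n with
  | zero => simp
  | succ n ih =>
    simp only [pow_succ', Equiv.Perm.mul_apply, ih, (subdivision_around M c _).1,
      (subdivision_around M c _).2.2.1, and_self]

theorem subdivision_vertexOf (x : X) :
    (𝒫).vertexOf (x, 3) = (𝒫).vertexOf (M.next (M.flip x), 1) ∧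
    (𝒫).vertexOf (x, 4) = (𝒫).vertexOf (M.next x, 1) := by
  constructor
  · rw [← (subdivision_around M c x).2.2.2.1, OrientedMap.vertexOf_around]
  · rw [← (𝒫).vertexOf_around (M.next x, 1), (subdivision_around M c _).2.1]
    simp

/-- The three corners at a new point of an edge have different numbers 1, 4, 3, so each such point
is indexed once by its corner number 1. -/
theorem subdivision_around_pow_one (x : X) :
    ((𝒫).around ^ 1) (x, 1) = (M.next⁻¹ x, 4) ∧
    ((𝒫).around ^ 2) (x, 1) = (M.flip (M.next⁻¹ x), 3) ∧ ((𝒫).around ^ 3) (x, 1) = (x, 1) := by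
  have h := subdivision_around M c
  simp [pow_succ, h, M.flip_flip]

theorem subdivision_vertexOf_one {x y : X} (h : (𝒫).vertexOf (x, 1) = (𝒫).vertexOf (y, 1)) :
    x = y := by
  obtain ⟨h1, h2, h3⟩ := subdivision_around_pow_one M c x
  rw [OrientedMap.vertexOf_eq] at h
  obtain ⟨j, hj, hj'⟩ := exists_pow_lt_of_sameCycle (m := 3) (by omega) h3 h
  interval_cases j
  · exact (Prod.mk.inj hj').1
  · rw [h1] at hj'
    exact absurd (Prod.mk.inj hj').2 (by decide)
  · rw [h2] at hj'
    exact absurd (Prod.mk.inj hj').2 (by decide)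

/-- The combinations of corners at the five vertices of a tile of the subdivision. -/
def vertexKind (k : ℕ) : Fin 5 → Multiset Corner :=
  ![Multiset.replicate k δ, {α, β, γ}, {α, α, α}, {α, β, γ}, {α, β, γ}]

theorem replicate_delta_ne {k : ℕ} (hk : 0 < k) :
    Multiset.replicate k δ ≠ {α, β, γ} ∧ Multiset.replicate k δ ≠ {α, α, α} := by
  constructor <;> intro h <;> have := congrArg (Multiset.count δ) h <;> simp at this <;> omega

variable {M c} {k : ℕ}

/-- Around a middle point or an old vertex all corners have the same number, so `h0` and `h2` settle
these. Only the new points of edges mix numbers; `h1` is the condition there, and corners 3 and 4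
reduce to corner 1 of another tile. -/
theorem cornersAt_subdivision [Finite X] (hM : M.IsTrivalent k) (hk : 0 < k)
    (h0 : ∀ x, c x 0 = δ) (h2 : ∀ x, c x 2 = α)
    (h1 : ∀ x, ({c x 1, c (M.next⁻¹ x) 4, c (M.flip (M.next⁻¹ x)) 3} : Multiset Corner) =
      {α, β, γ}) (x : X) (i : Fin 5) :
    (𝒫).cornersAt ((𝒫).vertexOf (x, i)) = vertexKind k i := by
  have key : ∀ x, (𝒫).cornersAt ((𝒫).vertexOf (x, 1)) = {α, β, γ} := by
    intro x
    obtain ⟨e1, e2, e3⟩ := subdivision_around_pow_one M c x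
    rw [(𝒫).cornersAt_vertexOf_eq (m := 3) (by omega) e3, ← h1 x]
    · rw [show Multiset.range 3 = {0, 1, 2} by decide]
      change ({(𝒫).corner _, (𝒫).corner (((𝒫).around ^ 1) (x, 1)),
        (𝒫).corner (((𝒫).around ^ 2) (x, 1))} : Multiset Corner) = _
      rw [e1, e2]
      rfl
    · intro j hj hj'
      interval_cases j
      · rw [e1]
        exact fun h => absurd (Prod.mk.inj h).2 (by decide)
      · rw [e2]
        exact fun h => absurd (Prod.mk.inj h).2 (by decide)
  obtain ⟨e3, e4⟩ := subdivision_vertexOf M c x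
  fin_cases i
  · refine ((𝒫).cornersAt_vertexOf_eq (m := k) hk ?_ ?_).trans ?_
    · exact (subdivision_around_pow M c k x).1.trans (by rw [hM.next_pow]; rfl)
    · intro j hj hj' h
      have h := (subdivision_around_pow M c j x).1.symm.trans h
      exact hM.next_pow_ne x j hj hj' (Prod.mk.inj h).1
    · refine Multiset.eq_replicate.2 ⟨by simp, fun b hb => ?_⟩
      obtain ⟨j, -, rfl⟩ := Multiset.mem_map.1 hb
      refine (congrArg (𝒫).corner (subdivision_around_pow M c j x).1).trans (h0 _)
  · exact key x
  · refine ((𝒫).cornersAt_vertexOf_eq (m := 3) (by omega) ?_ ?_).trans ?_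
    · exact (subdivision_around_pow M c 3 x).2.trans (by rw [hM.around_pow]; rfl)
    · intro j hj hj' h
      have h := (Prod.mk.inj ((subdivision_around_pow M c j x).2.symm.trans h)).1
      interval_cases j
      · exact hM.around_ne x h
      · have := hM.around_pow x
        rw [pow_succ', Equiv.Perm.mul_apply, h] at this
        exact hM.around_ne x this
    · refine (Multiset.eq_replicate (n := 3) (a := α)).2 ⟨by simp, fun b hb => ?_⟩
      obtain ⟨j, -, rfl⟩ := Multiset.mem_map.1 hb
      refine (congrArg (𝒫).corner (subdivision_around_pow M c j x).2).trans (h2 _)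
  · exact (congrArg _ e3).trans (key _)
  · exact (congrArg _ e4).trans (key _)

/-- The combinations separate all positions except 1, 3, 4. The points there are corners number 1 of
three different tiles. -/
theorem subdivision_vertexOf_injective [Finite X] (hM : M.IsTrivalent k) (hk : 1 < k)
    (hP : ∀ x i, (𝒫).cornersAt ((𝒫).vertexOf (x, i)) = vertexKind k i) (x : X) {i j : Fin 5}
    (h : (𝒫).vertexOf (x, i) = (𝒫).vertexOf (x, j)) : i = j := by
  have hkind : vertexKind k i = vertexKind k j := by rw [← hP x, ← hP x, h]
  obtain ⟨e3, e4⟩ := subdivision_vertexOf M c x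
  have h13 : (𝒫).vertexOf (x, 1) ≠ (𝒫).vertexOf (x, 3) := by
    rw [e3]
    intro h
    apply hM.around_ne (M.next (M.flip x))
    rw [M.around_next, M.flip_flip]
    exact subdivision_vertexOf_one M c h
  have h14 : (𝒫).vertexOf (x, 1) ≠ (𝒫).vertexOf (x, 4) := by
    rw [e4]
    intro h
    exact hM.next_pow_ne x 1 one_pos hk (subdivision_vertexOf_one M c h).symm
  have h34 : (𝒫).vertexOf (x, 3) ≠ (𝒫).vertexOf (x, 4) := by
    rw [e3, e4]
    intro h
    exact M.flip_ne x (M.next.injective (subdivision_vertexOf_one M c h))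
  obtain ⟨n1, n2⟩ := replicate_delta_ne (k := k) (by omega)
  have n3 : ({α, β, γ} : Multiset Corner) ≠ {α, α, α} := by decide
  fin_cases i <;> fin_cases j <;>
    first
    | rfl
    | exact absurd h h13
    | exact absurd h h14
    | exact absurd h h34
    | exact absurd h.symm h13
    | exact absurd h.symm h14
    | exact absurd h.symm h34
    | exact absurd hkind n1
    | exact absurd hkind n2
    | exact absurd hkind n3
    | exact absurd hkind.symm n1
    | exact absurd hkind.symm n2
    | exact absurd hkind.symm n3

/-- Three of the five positions lie at vertices `αβγ` of degree 3, one at `α³`, one at `δᵏ`. -/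
theorem natCard_vertex_kind [Finite X] (hk : 0 < k)
    (hP : ∀ x i, (𝒫).cornersAt ((𝒫).vertexOf (x, i)) = vertexKind k i) :
    Nat.card {v // (𝒫).cornersAt v = {α, β, γ}} = Nat.card X ∧
    3 * Nat.card {v // (𝒫).cornersAt v = {α, α, α}} = Nat.card X ∧
    k * Nat.card {v // (𝒫).cornersAt v = Multiset.replicate k δ} = Nat.card X := by
  obtain ⟨n1, n2⟩ := replicate_delta_ne hk
  have n3 : ({α, β, γ} : Multiset Corner) ≠ {α, α, α} := by decide
  have key : ∀ m s, (∀ i, vertexKind k i = m ↔ i ∈ (s : Finset (Fin 5))) →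
      m.card * Nat.card {v // (𝒫).cornersAt v = m} = s.card * Nat.card X := by
    intro m s hs
    let e : {d // (𝒫).cornersAt ((𝒫).vertexOf d) = m} ≃ s × X :=
      { toFun := fun d => (⟨d.1.2, (hs _).1 ((hP _ _).symm.trans d.2)⟩, d.1.1)
        invFun := fun y => ⟨(y.2, y.1), (hP _ _).trans ((hs _).2 y.1.2)⟩
        left_inv := fun _ => rfl
        right_inv := fun _ => rfl }
    rw [(𝒫).card_mul_card_cornersAt, Nat.card_congr e, Nat.card_prod]
    simp
  refine ⟨?_, ?_, ?_⟩
  · have := key {α, β, γ} {1, 3, 4} (by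
      intro i; fin_cases i <;> first
        | exact iff_of_true rfl (by decide)
        | exact iff_of_false n1 (by decide)
        | exact iff_of_false n3.symm (by decide))
    simpa using this
  · have := key {α, α, α} {2} (by
      intro i; fin_cases i <;> first
        | exact iff_of_true rfl (by decide)
        | exact iff_of_false n2 (by decide)
        | exact iff_of_false n3 (by decide))
    simpa using this
  · have := key (Multiset.replicate k δ) {0} (by
      intro i; fin_cases i <;> first
        | exact iff_of_true rfl (by decide)
        | exact iff_of_false n1.symm (by decide)
        | exact iff_of_false n2.symm (by decide))
    simpa using this

theorem natCard_subdivision_tile [Finite X] : Nat.card (𝒫).Tile = Nat.card X := by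
  have h : ∀ t : (𝒫).Tile, Nat.card {d // (𝒫).tileOf d = t} = 5 := by
    intro t
    obtain ⟨⟨x, i⟩, rfl⟩ := (𝒫).tileOf_surjective t
    simp only [OrientedMap.tileOf_eq]
    refine natCard_sameCycle (by omega) ?_ ?_
    · exact subdivision_next_pow_five M c x i
    · intro j hj hj' h
      rw [subdivision_next_pow] at h
      exact not_add_ofNat_eq hj hj' (Prod.mk.inj h).2
  have := card_fiber_mul_card _ 5 h
  rw [Nat.card_prod, Nat.card_fin] at this
  omega

theorem OrientedMap.natCard_edge {D : Type*} [Finite D] (M : OrientedMap D) :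
    2 * Nat.card M.Edge = Nat.card D := by
  refine card_fiber_mul_card
    (Quotient.mk (Equiv.Perm.SameCycle.setoid M.flip) : D → M.Edge) 2 fun v => ?_
  obtain ⟨d, rfl⟩ := Quotient.exists_rep v
  refine (Nat.card_congr (Equiv.subtypeEquivRight fun e => ?_)).trans
    (natCard_sameCycle (σ := M.flip) (d := d) (by omega) ?_ ?_)
  · exact Quotient.eq (r := Equiv.Perm.SameCycle.setoid M.flip)
  · exact M.flip_flip d
  · intro j hj hj'
    obtain rfl : j = 1 := by omega
    exact M.flip_ne d

/-- `next` sweeps out a tile; crossing side 4 realizes `M.next` and crossing side 3 realizes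
`M.flip`. -/
theorem subdivision_connected [Finite X]
    (hM : ∀ d e : X, ∃ g ∈ Subgroup.closure {M.next, M.flip}, g d = e) (a b : X × Fin 5) :
    ∃ g ∈ Subgroup.closure {(𝒫).next, (𝒫).flip}, g a = b := by
  refine (𝒫).connected_of_induction (a.1, 0) ?_ a b
  intro Q hn hf h0
  have hrow : ∀ (x : X) (i : Fin 5), Q (x, i) → ∀ j, Q (x, j) := by
    intro x i hi j
    have : ∀ n : ℕ, Q (((𝒫).next ^ n) (x, i)) := by
      intro n
      induction n with
      | zero => exact hi
      | succ n ih => rw [pow_succ']; exact hn _ ih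
    have h := this (j - i : Fin 5).val
    rw [subdivision_next_pow] at h
    rwa [Fin.ofNat_val_eq_self, add_sub_cancel] at h
  have := M.forall_of_connected hM (P := fun x => Q (x, 0))
    (fun x hx => hf (x, 4) (hrow x 0 hx 4))
    (fun x hx => hrow _ 3 (hf (x, 3) (hrow x 0 hx 3)) 0) h0
  exact fun d => hrow d.1 0 (this d.1) d.2

/-- `euler` is twice `V - E + F = 2` with `V = N + b + g`, `F = N` and `2E = 5N`, rearranged to
avoid subtraction. -/
theorem labelledSubdivision_isTilingFor [Finite X] {N b g : ℕ} (hM : M.IsTrivalent k) (hk : 1 < k)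
    (hN : Nat.card X = N) (hb : 3 * b = N) (hg : k * g = N)
    (euler : 2 * (N + b + g + N) = 5 * N + 4)
    (h0 : ∀ x, c x 0 = δ) (h2 : ∀ x, c x 2 = α)
    (h1 : ∀ x, ({c x 1, c (M.next⁻¹ x) 4, c (M.flip (M.next⁻¹ x)) 3} : Multiset Corner) =
      {α, β, γ})
    (p : ZMod 5 → Corner) (hp : Finset.univ.val.map p = {α, α, β, γ, δ})
    (ha : ∀ x, (∀ i : ZMod 5, c x i = p i) ∨ (∀ i : ZMod 5, c x i = p (-i))) :
    (𝒫).IsTilingFor (avcDelta k N b g) := by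
  classical
  have hP := cornersAt_subdivision hM (by omega) h0 h2 h1
  obtain ⟨c1, c2, c3⟩ := natCard_vertex_kind (by omega) hP
  have hT : Nat.card (𝒫).Tile = N := natCard_subdivision_tile.trans hN
  have hE := (𝒫).natCard_edge
  rw [Nat.card_prod, Nat.card_fin] at hE
  obtain ⟨n1, n2⟩ := replicate_delta_ne (k := k) (by omega)
  have n3 : ({α, β, γ} : Multiset Corner) ≠ {α, α, α} := by decide
  have hcases : ∀ v, (𝒫).cornersAt v = {α, β, γ} ∨ (𝒫).cornersAt v = {α, α, α} ∨
      (𝒫).cornersAt v = Multiset.replicate k δ := by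
    intro v
    obtain ⟨⟨x, i⟩, rfl⟩ := (𝒫).vertexOf_surjective v
    rw [hP]
    fin_cases i <;> simp [vertexKind]
  have hV : Nat.card (𝒫).Vertex = N + b + g := by
    have := Fintype.ofFinite (𝒫).Vertex
    have hs := Finset.card_eq_sum_card_fiberwise (f := (𝒫).cornersAt) (s := Finset.univ)
      (t := {{α, β, γ}, {α, α, α}, Multiset.replicate k δ}) (fun v _ => by
        simpa using hcases v)
    rw [Finset.sum_insert, Finset.sum_insert, Finset.sum_singleton] at hs
    · simp only [← Fintype.card_subtype, ← Nat.card_eq_fintype_card] at hs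
      rw [Finset.card_univ, ← Nat.card_eq_fintype_card] at hs
      have := Nat.eq_of_mul_eq_mul_left (show 0 < k by omega) (c3.trans (hN.trans hg.symm))
      omega
    · simpa using n2.symm
    · simp only [Finset.mem_insert, Finset.mem_singleton, not_or]
      exact ⟨n3, n1.symm⟩
  refine ⟨⟨subdivision_connected hM.connected, by rw [hV, hT]; omega⟩, ?_, hT,
    ⟨p, hp, ?_⟩, ?_⟩
  · rw [OrientedMap.allPentagons_iff]
    constructor
    · rintro ⟨x, i⟩
      exact subdivision_next_pow_five M c x i
    · rintro ⟨x, i⟩ j hj hj' h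
      rw [subdivision_next_pow] at h
      exact not_add_ofNat_eq hj hj' (subdivision_vertexOf_injective hM hk hP x h)
  · rintro ⟨x, j⟩
    rcases ha x with h | h
    · refine .inl ⟨j, fun i => ?_⟩
      rw [subdivision_next_pow]
      exact h _
    · refine .inr ⟨(-j : Fin 5), fun i => ?_⟩
      rw [subdivision_next_pow]
      refine (h _).trans (congrArg p ?_)
      exact neg_add' (α := ZMod 5) _ _
  · intro m
    simp only [avcDelta, Pi.add_apply, Pi.single_apply]
    by_cases m1 : m = {α, β, γ}
    · subst m1
      rw [if_pos rfl, if_neg n3, if_neg n1.symm, c1, hN, add_zero, add_zero]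
    by_cases m2 : m = {α, α, α}
    · subst m2
      rw [if_neg n3.symm, if_pos rfl, if_neg n2.symm]
      omega
    by_cases m3 : m = Multiset.replicate k δ
    · subst m3
      rw [if_neg n1, if_neg n2, if_pos rfl]
      have := Nat.eq_of_mul_eq_mul_left (show 0 < k by omega) (c3.trans (hN.trans hg.symm))
      omega
    · rw [if_neg m1, if_neg m2, if_neg m3]
      have : IsEmpty {v // (𝒫).cornersAt v = m} := by
        refine ⟨fun ⟨v, hv⟩ => ?_⟩
        subst hv
        rcases hcases v with h | h | h <;> contradiction
      simp

end subdivision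

/-! ### Handedness of the `δ` pattern -/

/-- A map with sides `D`, given by `n = next` and `f = flip`, all of whose tiles are pentagons with
exactly one distinguished corner, such that the distinguished corners are exactly the corners at the
vertices of degree `k`, and all the other vertices have degree `3`. -/
structure IsDeltaPattern {D : Type*} (n f : D → D) (Z : D → Prop) (k : ℕ) : Prop where
  n5 : ∀ d, n (n (n (n (n d)))) = d
  ff : ∀ d, f (f d) = d
  exists_delta : ∀ d, ∃ e, Z e ∧ (d = e ∨ d = n e ∨ d = n (n e) ∨ d = n (n (n e)) ∨
    d = n (n (n (n e))))
  not_delta : ∀ d, Z d → ¬Z (n d) ∧ ¬Z (n (n d)) ∧ ¬Z (n (n (n d))) ∧ ¬Z (n (n (n (n d))))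
  delta_iff : ∀ d, Z (n (f d)) ↔ Z d
  r3 : ∀ d, ¬Z d → n (f (n (f (n (f d))))) = d
  rk : ∀ d, Z d → (fun d => n (f d))^[k] d = d

namespace IsDeltaPattern
variable {D : Type*} {n f : D → D} {Z : D → Prop} {k : ℕ} (h : IsDeltaPattern n f Z k)
include h

theorem n_injective : Function.Injective n := fun a b hab => by
  rw [← h.n5 a, hab, h.n5]

theorem f_injective : Function.Injective f := fun a b hab => by
  rw [← h.ff a, hab, h.ff]

/-- A tile has only one distinguished corner to count from, so no side is both number 1 and number
3. This is the source of the contradiction in `second_of_second`. -/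
theorem position_ne {d e : D} (hd : Z d) (he : Z e) : n d ≠ n (n (n e)) := fun H =>
  (h.not_delta e he).2.1 (h.n_injective H ▸ hd)

/-- The tiles around a distinguished vertex are glued along side 4 and side 0. -/
theorem delta_f_four {d : D} (hd : Z d) :
    Z (f (n (n (n (n d))))) ∧ n (f (f (n (n (n (n d)))))) = d := by
  have : n (f (f (n (n (n (n d)))))) = d := by rw [h.ff, h.n5]
  exact ⟨(h.delta_iff _).1 (by rwa [this]), this⟩

/-- The two ways in which the third tile can be placed at the vertex between two adjacent tiles
with the same distinguished vertex. -/
theorem side_cases {d : D} (hd : Z d) : ∃ e, Z e ∧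
    ((f (n d) = n (n e) ∧ f (n (n (n (n (f d))))) = n (n (n e))) ∨
      (f (n d) = n e ∧ f (n (n (n (n (f d))))) = n (n e))) := by
  have h1 := (h.not_delta d hd).1
  have hz : ¬Z (n (f (n d))) := by rwa [h.delta_iff]
  have hr := h.r3 _ h1
  have hfz : f (n (f (n d))) = n (n (n (n (f d)))) := by
    apply h.n_injective
    apply h.f_injective
    apply h.n_injective
    rw [hr, h.n5, h.ff]
  have hfz' : f (n (n (n (n (f d))))) = n (f (n d)) := by rw [← hfz, h.ff]
  have hd' : Z (n (f d)) := (h.delta_iff d).2 hd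
  -- At the end of side 0 meet corner 1 of the tile of `d`, corner 4 of its neighbour and the corner
  -- `n (f (n d))` of a third tile. The last is not number 0, as the vertex is not distinguished.
  -- Number 1 or 4 would glue side 0 or 4, which has a distinguished end, to side 1 of the first
  -- tile or side 3 of the second. Numbers 3 and 2 remain: the first and the second way.
  obtain ⟨e, he, H | H | H | H | H⟩ := h.exists_delta (n (f (n d)))
  · exact absurd (H ▸ he) hz
  · exfalso
    have : f (n d) = e := h.n_injective H
    have h2 : n d = f e := by rw [← this, h.ff]
    have h3 := (h.delta_iff e).2 he
    rw [← h2] at h3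
    exact (h.not_delta d hd).2.1 h3
  · exact ⟨e, he, .inr ⟨h.n_injective H, hfz'.trans H⟩⟩
  · exact ⟨e, he, .inl ⟨h.n_injective H, hfz'.trans H⟩⟩
  · exfalso
    have h2 := (h.delta_f_four he).1
    rw [← H, hfz] at h2
    exact (h.not_delta _ hd').2.2.1 h2

/-- Corner 2 lies at a vertex of degree 3, whose remaining tile is the one across side 0 of `e`;
side 2 is therefore glued to side 3 of that tile. -/
theorem f_two_of_one {d e : D} (hd : Z d) (he : f (n d) = n e) :
    f (n (n d)) = n (n (n (n (f e)))) := by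
  have hr := h.r3 _ (h.not_delta d hd).2.1
  apply h.n_injective
  apply h.f_injective
  apply h.n_injective
  apply h.f_injective
  apply h.n_injective
  rw [hr, h.n5, h.ff, ← he, h.ff]

/-- The same argument at corner 3: side 2 is glued to side 1 of the tile across side 4 of `e`. -/
theorem f_two_of_three {d e : D} (hd : Z d) (he : f (n (n (n d))) = n (n (n e))) :
    f (n (n d)) = n (f (n (n (n (n e))))) := by
  have hr := h.r3 _ (h.not_delta d hd).2.2.1
  have h2 : f (n (f (n (n (n (n e)))))) = n (n d) := by
    apply h.n_injective
    rw [← hr, he]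
  rw [← h2, h.ff]

/-- If the third tile is placed in the second way at one vertex of `N(v)`, then also at the
next one. -/
theorem second_of_second {d e : D} (hd : Z d) (he : Z e) (H : f (n d) = n e) :
    ∃ e', Z e' ∧ f (n (f (n (n (n (n d)))))) = n e' ∧ f (n (n (n d))) = n (n e') := by
  obtain ⟨ha, hr⟩ := h.delta_f_four hd
  obtain ⟨e', he', ⟨-, h3⟩ | ⟨h1, h2⟩⟩ := h.side_cases ha
  -- With the first way here, side 2 of `d` would be glued both to a side 3 and to a side 1.
  · exfalso
    rw [hr] at h3
    have h4 := h.f_two_of_one hd H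
    rw [h.f_two_of_three hd h3] at h4
    exact h.position_ne (h.delta_f_four he').1 ((h.delta_iff e).2 he) h4
  · rw [hr] at h2
    exact ⟨e', he', h1, h2⟩

theorem second_iterate {d : D} (hd : Z d) (H : ∃ e, Z e ∧ f (n d) = n e) (j : ℕ) :
    Z ((fun d => f (n (n (n (n d)))))^[j] d) ∧
      ∃ e, Z e ∧ f (n ((fun d => f (n (n (n (n d)))))^[j] d)) = n e := by
  induction j with
  | zero => exact ⟨hd, H⟩
  | succ j ih =>
    obtain ⟨h1, e, h2, h3⟩ := ih
    obtain ⟨e', h4, h5, -⟩ := h.second_of_second h1 h2 h3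
    rw [Function.iterate_succ_apply']
    exact ⟨(h.delta_f_four h1).1, e', h4, h5⟩

theorem rotate_iterate {d : D} (hd : Z d) :
    (fun d => f (n (n (n (n d)))))^[k] d = d := by
  have hl : Function.LeftInverse (fun d => f (n (n (n (n d))))) (fun d => n (f d)) := fun d => by
    simp only [h.n5, h.ff]
  conv_lhs => rw [← h.rk d hd]
  exact hl.iterate k d

/-- The preceding tile around a vertex of degree `k` is reached by `k - 1` steps forward. -/
theorem second_prev (hk : 0 < k) {d : D} (hd : Z d) (H : ∃ e, Z e ∧ f (n d) = n e) :
    ∃ e, Z e ∧ f (n (n (f d))) = n e := by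
  have h1 := h.rotate_iterate hd
  obtain ⟨j, rfl⟩ : ∃ j, k = j + 1 := ⟨k - 1, by omega⟩
  rw [Function.iterate_succ_apply'] at h1
  have h2 := h.second_iterate hd H j
  rw [← (h.delta_f_four h2.1).2, h1] at h2
  exact h2.2

/-- In a connected pattern the third tiles are all placed in the same way. -/
theorem all_first_or_all_second (hk : 0 < k)
    (hconn : ∀ P : D → Prop, (∀ d, P d → P (n d)) → (∀ d, P d → P (f d)) → ∀ a, P a → ∀ d, P d) :
    (∀ d, Z d → ∃ e, Z e ∧ f (n (n (n d))) = n (n (n e))) ∨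
      ∀ d, Z d → ∃ e, Z e ∧ f (n d) = n e := by
  by_cases H : ∃ d, Z d ∧ ∃ e, Z e ∧ f (n d) = n e
  · right
    obtain ⟨a, ha⟩ := H
    let S : D → Prop := fun d => Z d ∧ ∃ e, Z e ∧ f (n d) = n e
    have hS : ∀ d e, S d → Z e → f (n d) = n e → S e := fun d e hd he hde =>
      ⟨he, d, hd.1, by rw [← hde, h.ff]⟩
    have hprev : ∀ d, S d → S (n (f d)) := fun d hd =>
      ⟨(h.delta_iff d).2 hd.1, h.second_prev hk hd.1 hd.2⟩
    have hnext : ∀ d, S d → S (f (n (n (n (n d))))) := fun d hd => by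
      obtain ⟨e, he, hde⟩ := hd.2
      obtain ⟨e', h1, h2, -⟩ := h.second_of_second hd.1 he hde
      exact ⟨(h.delta_f_four hd.1).1, e', h1, h2⟩
    -- The union of the tiles in `S` is closed under crossing each of the five sides, so by
    -- connectedness it is everything.
    have key := hconn (fun x => ∃ d, S d ∧ (x = d ∨ x = n d ∨ x = n (n d) ∨ x = n (n (n d)) ∨
      x = n (n (n (n d))))) ?_ ?_ a ⟨a, ha, .inl rfl⟩
    · intro d hd
      obtain ⟨e, he, rfl | rfl | rfl | rfl | rfl⟩ := key d
      · exact he.2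
      · exact absurd hd (h.not_delta e he.1).1
      · exact absurd hd (h.not_delta e he.1).2.1
      · exact absurd hd (h.not_delta e he.1).2.2.1
      · exact absurd hd (h.not_delta e he.1).2.2.2
    · rintro x ⟨d, hd, rfl | rfl | rfl | rfl | rfl⟩
      · exact ⟨x, hd, by simp⟩
      · exact ⟨d, hd, by simp⟩
      · exact ⟨d, hd, by simp⟩
      · exact ⟨d, hd, by simp⟩
      · exact ⟨d, hd, by simp [h.n5]⟩
    · rintro x ⟨d, hd, rfl | rfl | rfl | rfl | rfl⟩
      · exact ⟨_, hprev _ hd, by simp [h.n5]⟩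
      · obtain ⟨e, he, hde⟩ := hd.2
        exact ⟨e, hS d e hd he hde, by simp [hde]⟩
      · obtain ⟨e, he, hde⟩ := hd.2
        exact ⟨_, hprev e (hS d e hd he hde), by simp [h.f_two_of_one hd.1 hde]⟩
      · obtain ⟨e, he, hde⟩ := hd.2
        obtain ⟨e', h1, h2, h3⟩ := h.second_of_second hd.1 he hde
        exact ⟨e', hS _ e' (hnext d hd) h1 h2, by simp [h3]⟩
      · exact ⟨_, hnext d hd, by simp⟩
  · left
    intro d hd
    obtain ⟨ha, hr⟩ := h.delta_f_four hd
    -- Side 3 of `d` is seen from the tile across side 4, for which `d` is the neighbour across side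
    -- 0.
    obtain ⟨e, he, ⟨-, h3⟩ | ⟨h1, -⟩⟩ := h.side_cases ha
    · exact ⟨e, he, by rw [← h3, hr]⟩
    · exact absurd ⟨_, ha, e, he, h1⟩ H

end IsDeltaPattern

/-! ### Recovering the subdivided map -/

/-- The pattern of the pentagonal subdivision: with the distinguished corner as number `0`, the
sides number `3` are matched with sides number `3`. -/
structure IsSubdivisionPattern {D : Type*} (n f : D → D) (Z : D → Prop) (k : ℕ) : Prop extends
    IsDeltaPattern n f Z k where
  three : ∀ d, Z d → ∃ e, Z e ∧ f (n (n (n d))) = n (n (n e))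

namespace IsSubdivisionPattern
variable {D : Type*} {n f : D → D} {Z : D → Prop} {k : ℕ} (h : IsSubdivisionPattern n f Z k)

/-- The rotation of the sides of a tile of the subdivided map. -/
def rotate (d : {d // Z d}) : {d // Z d} := ⟨f (n (n (n (n d.1)))), (h.delta_f_four d.2).1⟩

/-- The exchange of the two sides at an edge of the subdivided map. -/
def turn (d : {d // Z d}) : {d // Z d} := ⟨n (n (f (n (n (n d.1))))), by
  obtain ⟨e, he, hde⟩ := h.three d.1 d.2
  rwa [hde, h.n5]⟩

theorem flip_four (d : {d // Z d}) : f (n (n (n (n d.1)))) = (h.rotate d).1 := rfl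

theorem flip_zero (d : {d // Z d}) : f (h.rotate d).1 = n (n (n (n d.1))) := h.ff _

theorem flip_three (d : {d // Z d}) : f (n (n (n d.1))) = n (n (n (h.turn d).1)) := by
  change _ = n (n (n (n (n (f (n (n (n d.1))))))))
  rw [h.n5]

/-- This completes the gluings 0–4, 1–2, 3–3 in terms of `rotate` and `turn` alone. -/
theorem flip_two (d : {d // Z d}) : f (n (n d.1)) = n (h.rotate (h.turn d)).1 :=
  h.f_two_of_three d.2 (h.flip_three d)

theorem turn_turn (d : {d // Z d}) : h.turn (h.turn d) = d := by
  apply Subtype.ext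
  have h1 := h.flip_three (h.turn d)
  rw [← h.flip_three, h.ff] at h1
  exact (h.n_injective (h.n_injective (h.n_injective h1))).symm

theorem flip_one (d : {d // Z d}) : f (n (h.rotate d).1) = n (n (h.turn d).1) := by
  have := h.flip_two (h.turn d)
  rw [turn_turn] at this
  rw [← this, h.ff]

theorem rotate_iterate (d : {d // Z d}) : h.rotate^[k] d = d := by
  apply Subtype.ext
  have : ∀ j, (h.rotate^[j] d).1 = (fun d => f (n (n (n (n d)))))^[j] d.1 := by
    intro j
    induction j with
    | zero => rfl
    | succ j ih => rw [Function.iterate_succ_apply', Function.iterate_succ_apply', ← ih]; rfl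
  rw [this, h.toIsDeltaPattern.rotate_iterate d.2]

/-- Going round the vertex at corner 2, which has degree 3, is `rotate ∘ turn` on tiles. -/
theorem rotate_turn (d : {d // Z d}) :
    h.rotate (h.turn (h.rotate (h.turn (h.rotate (h.turn d))))) = d := by
  apply Subtype.ext
  have := h.r3 _ (h.not_delta _ d.2).2.1
  rw [h.flip_two, h.flip_two, h.flip_two] at this
  exact h.n_injective (h.n_injective this)

end IsSubdivisionPattern


/-! ### From a tiling to its pattern, and the placement of the symbols -/

instance : Fintype Corner where
  elems := {α, β, γ, δ, ε}
  complete := by rintro ⟨⟩ <;> decide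

namespace CornerMap
variable {D : Type*} [Finite D] {T : CornerMap D} {k N b g : ℕ}

theorem IsTilingFor.cornersAt_cases (h : T.IsTilingFor (avcDelta k N b g)) (v : T.Vertex) :
    T.cornersAt v = {α, β, γ} ∨ T.cornersAt v = {α, α, α} ∨
      T.cornersAt v = Multiset.replicate k δ := by
  by_contra! hv
  have := h.vertices (T.cornersAt v)
  simp only [avcDelta, Pi.add_apply, Pi.single_apply, if_neg hv.1, if_neg hv.2.1,
    if_neg hv.2.2] at this
  -- `Nat.card` is also 0 on infinite types, which finiteness of `D` excludes.
  rcases Nat.card_eq_zero.1 this with h1 | h1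
  · exact h1.false ⟨v, rfl⟩
  · exact h1.not_finite inferInstance

/-- The only vertex combination that contains `δ` contains nothing else. -/
theorem IsTilingFor.corner_eq_delta_iff (h : T.IsTilingFor (avcDelta k N b g)) (d : D) :
    T.corner d = δ ↔ T.cornersAt (T.vertexOf d) = Multiset.replicate k δ := by
  have hm := T.corner_mem_cornersAt d
  constructor
  · intro hd
    rw [hd] at hm
    rcases h.cornersAt_cases (T.vertexOf d) with h1 | h1 | h1
    · rw [h1] at hm; exact absurd hm (by decide)
    · rw [h1] at hm; exact absurd hm (by decide)
    · exact h1
  · intro hd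
    rw [hd] at hm
    exact Multiset.eq_of_mem_replicate hm

theorem IsTilingFor.cornersAt_of_ne_delta (h : T.IsTilingFor (avcDelta k N b g)) {d : D}
    (hd : T.corner d ≠ δ) : T.cornersAt (T.vertexOf d) = {α, β, γ} ∨
      T.cornersAt (T.vertexOf d) = {α, α, α} := by
  rw [Ne, h.corner_eq_delta_iff] at hd
  rcases h.cornersAt_cases (T.vertexOf d) with h1 | h1 | h1
  · exact .inl h1
  · exact .inr h1
  · exact absurd h1 hd

theorem next_flip_iterate {m : ℕ} {d : D} (hd : (T.around ^ m) d = d) :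
    (fun d => T.next (T.flip d))^[m] d = d := by
  have : (fun d => T.next (T.flip d)) = T.around⁻¹ := by
    funext d; rw [OrientedMap.around_inv_apply]
  rw [this, Equiv.Perm.iterate_eq_pow, inv_pow, Equiv.Perm.inv_eq_iff_eq, hd]

theorem IsTilingFor.three_of_ne_delta (h : T.IsTilingFor (avcDelta k N b g)) {d : D}
    (hd : T.corner d ≠ δ) :
    T.next (T.flip (T.next (T.flip (T.next (T.flip d))))) = d ∧
    (({T.corner d, T.corner (T.next (T.flip (T.next (T.flip d)))), T.corner (T.next (T.flip d))} :
        Multiset Corner) = {α, β, γ} ∨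
      ({T.corner d, T.corner (T.next (T.flip (T.next (T.flip d)))), T.corner (T.next (T.flip d))} :
        Multiset Corner) = {α, α, α}) := by
  have hc : (T.cornersAt (T.vertexOf d)).card = 3 := by
    rcases h.cornersAt_of_ne_delta hd with h1 | h1 <;> rw [h1] <;> rfl
  obtain ⟨h1, h2⟩ := T.cornersAt_vertexOf d
  rw [hc] at h1 h2
  have h3 : T.next (T.flip (T.next (T.flip (T.next (T.flip d))))) = d := next_flip_iterate h1
  refine ⟨h3, ?_⟩
  have hr : ∀ e, T.around (T.next (T.flip e)) = e := fun e => by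
    rw [OrientedMap.around_next, T.flip_flip]
  have e1 : T.around d = T.next (T.flip (T.next (T.flip d))) := by
    conv_lhs => rw [← h3]
    rw [hr]
  have e2 : (T.around ^ 2) d = T.next (T.flip d) := by
    rw [pow_two, Equiv.Perm.mul_apply, e1, hr]
  rw [show Multiset.range 3 = {0, 1, 2} by decide] at h2
  have h4 : T.cornersAt (T.vertexOf d) = {T.corner d,
      T.corner (T.next (T.flip (T.next (T.flip d)))), T.corner (T.next (T.flip d))} := by
    rw [← e1, ← e2]
    exact h2
  rw [← h4]
  exact h.cornersAt_of_ne_delta hd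

/-- The cyclic arrangement is cut open at its unique `δ`, leaving a word of four symbols that each
tile reads forwards or backwards. -/
theorem exists_arrangement_from_delta (h : T.IsTilingFor (avcDelta k N b g)) :
    ∃ s₁ s₂ s₃ s₄ : Corner, ({s₁, s₂, s₃, s₄} : Multiset Corner) = {α, α, β, γ} ∧
      (∀ d, ∃ i < 5, T.corner ((T.next ^ i) d) = δ) ∧
      ∀ d, T.corner d = δ →
        (T.corner ((T.next ^ 1) d) = s₁ ∧ T.corner ((T.next ^ 2) d) = s₂ ∧
          T.corner ((T.next ^ 3) d) = s₃ ∧ T.corner ((T.next ^ 4) d) = s₄) ∨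
        (T.corner ((T.next ^ 1) d) = s₄ ∧ T.corner ((T.next ^ 2) d) = s₃ ∧
          T.corner ((T.next ^ 3) d) = s₂ ∧ T.corner ((T.next ^ 4) d) = s₁) := by
  obtain ⟨p, hp, ha⟩ := h.congruent
  change Finset.univ.val.map p = {α, α, β, γ, δ} at hp
  obtain ⟨k₀, -, hk₀⟩ := Multiset.mem_map.1 (show δ ∈ Finset.univ.val.map p by rw [hp]; decide)
  have hs : Finset.univ.val.map (fun i => p (k₀ + i)) = {α, α, β, γ, δ} := by
    rw [← hp]
    have := congrArg Finset.val (Finset.map_univ_equiv (Equiv.addLeft k₀))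
    conv_rhs => rw [← this]
    rw [Finset.map_val, Multiset.map_map]
    rfl
  have hs' : ({p (k₀ + 1), p (k₀ + 2), p (k₀ + 3), p (k₀ + 4)} : Multiset Corner) =
      {α, α, β, γ} := by
    have h1 : Finset.univ.val.map (fun i => p (k₀ + i)) =
        p (k₀ + 0) ::ₘ {p (k₀ + 1), p (k₀ + 2), p (k₀ + 3), p (k₀ + 4)} := by
      rw [show (Finset.univ : Finset (ZMod 5)).val = {0, 1, 2, 3, 4} by decide]
      rfl
    rw [h1, add_zero, hk₀, show ({α, α, β, γ, δ} : Multiset Corner) = δ ::ₘ {α, α, β, γ} by decide,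
      Multiset.cons_inj_right] at hs
    exact hs
  have huniq : ∀ j, p j = δ → j = k₀ := by
    intro j hj
    by_contra hne
    have hne' : j - k₀ ≠ 0 := sub_ne_zero.2 hne
    have hj' : p (k₀ + (j - k₀)) = δ := by rw [add_sub_cancel, hj]
    have hmem : δ ∈ ({p (k₀ + 1), p (k₀ + 2), p (k₀ + 3), p (k₀ + 4)} : Multiset Corner) := by
      have : ∀ i : ZMod 5, i ≠ 0 → i = 1 ∨ i = 2 ∨ i = 3 ∨ i = 4 := by decide
      rcases this _ hne' with e | e | e | e <;> rw [e] at hj' <;> simp [hj']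
    rw [hs'] at hmem
    exact absurd hmem (by decide)
  refine ⟨_, _, _, _, hs', fun d => ?_, fun d hd => ?_⟩
  · have hv : ∀ j : ZMod 5, ((j.val : ℕ) : ZMod 5) = j := ZMod.natCast_zmod_val
    rcases ha d with ⟨j, hj⟩ | ⟨j, hj⟩
    · refine ⟨(k₀ - j).val, ZMod.val_lt _, ?_⟩
      rw [hj, hv, add_sub_cancel, hk₀]
    · refine ⟨(j - k₀).val, ZMod.val_lt _, ?_⟩
      rw [hj, hv, sub_sub_cancel, hk₀]
  · rcases ha d with ⟨j, hj⟩ | ⟨j, hj⟩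
    · obtain rfl := huniq j (by simpa using (hj 0).symm.trans hd)
      left
      exact ⟨(hj 1).trans (by push_cast; rfl), hj 2, hj 3, hj 4⟩
    · obtain rfl := huniq j (by simpa using (hj 0).symm.trans hd)
      right
      have e : ∀ a b : ZMod 5, a + b = 0 → j - a = j + b := fun a b hab => by
        rw [sub_eq_add_neg, eq_neg_of_add_eq_zero_right hab]
      exact ⟨(hj 1).trans (congrArg p (e _ _ (by decide))),
        (hj 2).trans (congrArg p (e _ _ (by decide))),
        (hj 3).trans (congrArg p (e _ _ (by decide))),
        (hj 4).trans (congrArg p (e _ _ (by decide)))⟩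

theorem IsTilingFor.isDeltaPattern (h : T.IsTilingFor (avcDelta k N b g)) :
    IsDeltaPattern T.next T.flip (fun d => T.corner d = δ) k := by
  obtain ⟨s₁, s₂, s₃, s₄, hs, hex, ha⟩ := exists_arrangement_from_delta h
  have n5 : ∀ d, T.next (T.next (T.next (T.next (T.next d)))) = d := fun d => (h.pentagons d).1
  have hδ : δ ∉ ({s₁, s₂, s₃, s₄} : Multiset Corner) := by rw [hs]; decide
  simp only [Multiset.insert_eq_cons, Multiset.mem_cons, Multiset.mem_singleton, not_or] at hδ
  obtain ⟨m1, m2, m3, m4⟩ := hδ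
  refine ⟨n5, T.flip_flip, fun d => ?_, fun d hd => ?_, fun d => ?_,
    fun d hd => (h.three_of_ne_delta hd).1, fun d hd => ?_⟩
  · obtain ⟨i, hi, hd⟩ := hex d
    refine ⟨_, hd, ?_⟩
    interval_cases i
    · exact .inl rfl
    · exact .inr (.inr (.inr (.inr (n5 d).symm)))
    · exact .inr (.inr (.inr (.inl (n5 d).symm)))
    · exact .inr (.inr (.inl (n5 d).symm))
    · exact .inr (.inl (n5 d).symm)
  · rcases ha d hd with ⟨h1, h2, h3, h4⟩ | ⟨h1, h2, h3, h4⟩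
    · exact ⟨fun e => m1 (e.symm.trans h1), fun e => m2 (e.symm.trans h2),
        fun e => m3 (e.symm.trans h3), fun e => m4 (e.symm.trans h4)⟩
    · exact ⟨fun e => m4 (e.symm.trans h1), fun e => m3 (e.symm.trans h2),
        fun e => m2 (e.symm.trans h3), fun e => m1 (e.symm.trans h4)⟩
  · rw [h.corner_eq_delta_iff, h.corner_eq_delta_iff, ← T.vertexOf_around, T.around_next,
      T.flip_flip]
  · have h1 := (T.cornersAt_vertexOf d).1
    rw [(h.corner_eq_delta_iff d).1 hd, Multiset.card_replicate] at h1
    exact next_flip_iterate h1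

/-- A tiling or its mirror image follows the pattern of the pentagonal subdivision. -/
theorem IsTilingFor.isSubdivisionPattern_or_mirror (h : T.IsTilingFor (avcDelta k N b g))
    (hk : 0 < k) :
    IsSubdivisionPattern T.next T.flip (fun d => T.corner d = δ) k ∨
      IsSubdivisionPattern T.mirror.next T.mirror.flip (fun d => T.mirror.corner d = δ) k := by
  have hp := h.isDeltaPattern
  rcases hp.all_first_or_all_second hk (fun P h1 h2 a ha => T.forall_of_connected h.sphere.1 h1 h2 ha)
    with h3 | h3
  · exact .inl ⟨hp, h3⟩
  · refine .inr ⟨h.mirror.isDeltaPattern, fun d hd => ?_⟩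
    obtain ⟨e, he, hde⟩ := h3 _ hd
    have hi : ∀ d, T.mirror.next d = T.next (T.next (T.next (T.next d))) := fun d => by
      change T.next⁻¹ d = _
      rw [Equiv.Perm.inv_eq_iff_eq, hp.n5]
    have hn : ∀ d, T.next (T.mirror.next d) = d := fun d => by rw [hi, hp.n5]
    -- A mirrored side carries the corner of its old successor, so the `δ` of `e` sits at the old
    -- predecessor of `e`. Side 3 counted in the mirror image is the old side 1.
    refine ⟨T.mirror.next e, (congrArg T.corner (hn e)).trans he, ?_⟩
    change T.flip _ = _
    simp only [hi, hp.n5]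
    exact hde

end CornerMap

/-- The possible corners of the tiles, in the pattern of the pentagonal subdivision. -/
theorem corner_cases {E : Type*} {rotate turn : E → E} {c₁ c₂ c₃ c₄ : E → Corner}
    {s₁ s₂ s₃ s₄ : Corner} (hs : ({s₁, s₂, s₃, s₄} : Multiset Corner) = {α, α, β, γ})
    (hc : ∀ d, (c₁ d = s₁ ∧ c₂ d = s₂ ∧ c₃ d = s₃ ∧ c₄ d = s₄) ∨
      (c₁ d = s₄ ∧ c₂ d = s₃ ∧ c₃ d = s₂ ∧ c₄ d = s₁))
    (h2 : ∀ d, c₂ d = α)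
    (h1 : ∀ d, ({c₁ (rotate d), c₄ d, c₃ (turn d)} : Multiset Corner) = {α, β, γ} ∨
      ({c₁ (rotate d), c₄ d, c₃ (turn d)} : Multiset Corner) = {α, α, α}) :
    (∀ d, c₁ d = α ∧ c₃ d = γ ∧ c₄ d = β) ∨ (∀ d, c₁ d = α ∧ c₃ d = β ∧ c₄ d = γ) ∨
    (∀ d, c₁ d = β ∧ c₃ d = γ ∧ c₄ d = α) ∨ (∀ d, c₁ d = γ ∧ c₃ d = β ∧ c₄ d = α) ∨
    ∀ d, c₃ d = α ∧ ((c₁ d = β ∧ c₄ d = γ) ∨ (c₁ d = γ ∧ c₄ d = β)) ∧ c₁ (rotate d) = c₁ d := by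
  rcases isEmpty_or_nonempty E with hE | ⟨⟨a⟩⟩
  · exact .inl fun d => isEmptyElim d
  -- Reversing the arrangement interchanges `s₂` and `s₃`.
  wlog h : s₂ = α generalizing s₁ s₂ s₃ s₄
  · refine this (s₁ := s₄) (s₂ := s₃) (s₃ := s₂) (s₄ := s₁) ?_ (fun d => (hc d).symm) ?_
    · rw [← hs]
      simp only [Multiset.insert_eq_cons, ← Multiset.coe_singleton, Multiset.cons_coe,
        Multiset.coe_eq_coe]
      exact List.reverse_perm [s₁, s₂, s₃, s₄]
    · rcases hc a with ⟨-, ha, -⟩ | ⟨-, ha, -⟩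
      · exact absurd (ha.symm.trans (h2 a)) h
      · exact ha.symm.trans (h2 a)
  subst h
  have key : ∀ s₁ s₃ s₄, ({s₁, α, s₃, s₄} : Multiset Corner) = {α, α, β, γ} →
      (s₃ ≠ α ∧ ((s₁ = α ∧ s₃ = γ ∧ s₄ = β) ∨ (s₁ = α ∧ s₃ = β ∧ s₄ = γ) ∨
        (s₁ = β ∧ s₃ = γ ∧ s₄ = α) ∨ (s₁ = γ ∧ s₃ = β ∧ s₄ = α))) ∨
      (s₃ = α ∧ ((s₁ = β ∧ s₄ = γ) ∨ (s₁ = γ ∧ s₄ = β))) := by decide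
  -- If `s₃ ≠ α`, then `c₂ = α` excludes the backward reading. If `s₃ = α`, both readings remain
  -- possible.
  rcases key s₁ s₃ s₄ hs with ⟨h3, h⟩ | ⟨rfl, h⟩
  · have hc' : ∀ d, c₁ d = s₁ ∧ c₃ d = s₃ ∧ c₄ d = s₄ := by
      intro d
      rcases hc d with ⟨e1, -, e3, e4⟩ | ⟨-, e2, -⟩
      · exact ⟨e1, e3, e4⟩
      · exact absurd (e2.symm.trans (h2 d)) h3
    rcases h with ⟨rfl, rfl, rfl⟩ | ⟨rfl, rfl, rfl⟩ | ⟨rfl, rfl, rfl⟩ | ⟨rfl, rfl, rfl⟩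
    · exact .inl hc'
    · exact .inr (.inl hc')
    · exact .inr (.inr (.inl hc'))
    · exact .inr (.inr (.inr (.inl hc')))
  · refine .inr (.inr (.inr (.inr ?_)))
    have h3 : ∀ d, c₃ d = α := fun d => by rcases hc d with e | e <;> exact e.2.2.1
    have h14 : ∀ d, (c₁ d = β ∧ c₄ d = γ) ∨ (c₁ d = γ ∧ c₄ d = β) := by
      intro d
      rcases h with ⟨rfl, rfl⟩ | ⟨rfl, rfl⟩ <;> rcases hc d with e | e <;> simp [e]
    refine fun d => ⟨h3 d, h14 d, ?_⟩
    have := h1 d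
    rw [h3] at this
    -- Opposite choices in `d` and `rotate d` would produce a vertex `αββ` or `αγγ`.
    rcases h14 d with e | e <;> rcases h14 (rotate d) with e' | e' <;>
      rw [e.2, e'.1] at this <;> rw [e.1, e'.1]
    all_goals exact absurd this (by decide)

/-- `αβγ` needs three different symbols and only two are available, so the vertex is `α³`. -/
theorem eq_alpha_of_pair {s t x y z : Corner} (hx : x = s ∨ x = t) (hy : y = s ∨ y = t)
    (hz : z = s ∨ z = t) (h : ({x, y, z} : Multiset Corner) = {α, β, γ} ∨
      ({x, y, z} : Multiset Corner) = {α, α, α}) : x = α := by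
  revert s t x y z
  decide


/-! ### The reductions as labelled subdivisions -/

section base
variable {X : Type*} {M : OrientedMap X} {k N b g : ℕ}

open Classical in
/-- The corners of the `4D₂` reduction, with `β` and `γ` exchanged in some of the tiles. -/
noncomputable def exchangeCorner (o : X → Prop) (x : X) (i : Fin 5) : Corner :=
  if o x then Equiv.swap β γ (label4D2 (subdivisionCorner i)) else label4D2 (subdivisionCorner i)

theorem exchangeCorner_of {o : X → Prop} {x : X} (h : o x) :
    exchangeCorner o x = fun i => Equiv.swap β γ (label4D2 (subdivisionCorner i)) := by
  funext i
  exact if_pos h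

theorem exchangeCorner_of_not {o : X → Prop} {x : X} (h : ¬o x) :
    exchangeCorner o x = fun i => label4D2 (subdivisionCorner i) := by
  funext i
  exact if_neg h

/-- The `4D₂` reduction, with `β` and `γ` exchanged in some of the tiles. -/
noncomputable def partialExchange (M : OrientedMap X) (o : X → Prop) : CornerMap (X × Fin 5) :=
  labelledSubdivision M (exchangeCorner o)

theorem partialExchange_congr {o o' : X → Prop} (h : ∀ x, o x ↔ o' x) :
    partialExchange M o = partialExchange M o' :=
  congrArg _ (funext fun x => propext (h x))

theorem relabel_eq_partialExchange :
    (pentSubdivision M).relabel label4D2 = partialExchange M fun _ => False :=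
  congrArg (labelledSubdivision M) (funext fun _ => (exchangeCorner_of_not (by simp)).symm)

theorem vertexOf_middle (x : X) : ((pentSubdivision M).relabel label4D2).vertexOf (M.next⁻¹ x, 0) =
    ((pentSubdivision M).relabel label4D2).vertexOf (x, 0) := by
  have h := (subdivision_around M (fun _ i => label4D2 (subdivisionCorner i)) (M.next⁻¹ x)).1
  rw [show M.next (M.next⁻¹ x) = x by simp] at h
  rw [← h]
  exact (OrientedMap.vertexOf_around _ _).symm

variable [Finite X]

theorem isTilingFor_4D1 (hM : M.IsTrivalent k) (hk : 1 < k)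
    (hN : Nat.card X = N) (hb : 3 * b = N) (hg : k * g = N)
    (euler : 2 * (N + b + g + N) = 5 * N + 4) :
    ((pentSubdivision M).relabel label4D1).IsTilingFor (avcDelta k N b g) :=
  labelledSubdivision_isTilingFor (c := fun _ i => label4D1 (subdivisionCorner i)) hM hk hN hb hg
    euler (fun _ => rfl) (fun _ => rfl) (fun _ => by decide)
    (fun i : Fin 5 => label4D1 (subdivisionCorner i)) (by decide) (fun _ => .inl fun _ => rfl)

theorem isTilingFor_4D3 (hM : M.IsTrivalent k) (hk : 1 < k)
    (hN : Nat.card X = N) (hb : 3 * b = N) (hg : k * g = N)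
    (euler : 2 * (N + b + g + N) = 5 * N + 4) :
    ((pentSubdivision M).relabel label4D3).IsTilingFor (avcDelta k N b g) :=
  labelledSubdivision_isTilingFor (c := fun _ i => label4D3 (subdivisionCorner i)) hM hk hN hb hg
    euler (fun _ => rfl) (fun _ => rfl) (fun _ => by decide)
    (fun i : Fin 5 => label4D3 (subdivisionCorner i)) (by decide) (fun _ => .inl fun _ => rfl)

/-- From `δ` the `4D₂` tile reads `δβααγ`, so exchanging `β` and `γ` is reading it backwards. At a
new point of an edge, corners 1 and 4 belong to consecutive tiles around a middle point; by `ho`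
they are still one `β` and one `γ`. -/
theorem isTilingFor_partialExchange (hM : M.IsTrivalent k) (hk : 1 < k)
    (hN : Nat.card X = N) (hb : 3 * b = N) (hg : k * g = N)
    (euler : 2 * (N + b + g + N) = 5 * N + 4) {o : X → Prop} (ho : ∀ x, o (M.next⁻¹ x) ↔ o x) :
    (partialExchange M o).IsTilingFor (avcDelta k N b g) := by
  refine labelledSubdivision_isTilingFor (c := exchangeCorner o) hM hk hN hb hg euler (fun x => ?_)
    (fun x => ?_) (fun x => ?_) (fun i : Fin 5 => label4D2 (subdivisionCorner i)) (by decide)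
    (fun x => ?_)
  · by_cases h : o x
    · rw [exchangeCorner_of h]; decide
    · rw [exchangeCorner_of_not h]; decide
  · by_cases h : o x
    · rw [exchangeCorner_of h]; decide
    · rw [exchangeCorner_of_not h]; decide
  · have h3 : exchangeCorner o (M.flip (M.next⁻¹ x)) 3 = α := by
      by_cases h : o (M.flip (M.next⁻¹ x))
      · rw [exchangeCorner_of h]; decide
      · rw [exchangeCorner_of_not h]; decide
    rw [h3]
    by_cases h : o x
    · rw [exchangeCorner_of h, exchangeCorner_of ((ho x).2 h)]; decide
    · rw [exchangeCorner_of_not h, exchangeCorner_of_not (mt (ho x).1 h)]; decide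
  · by_cases h : o x
    · right
      rw [exchangeCorner_of h]; decide
    · left
      rw [exchangeCorner_of_not h]
      exact fun _ => rfl

/-- A vertex of the `4D₂` reduction with all corners `δ` is the middle of a tile of `M`. -/
theorem cornersAt_4D2 (hM : M.IsTrivalent k) (hk : 0 < k) (x : X) (i : Fin 5) :
    ((pentSubdivision M).relabel label4D2).cornersAt
      (((pentSubdivision M).relabel label4D2).vertexOf (x, i)) = vertexKind k i :=
  cornersAt_subdivision (c := fun _ i => label4D2 (subdivisionCorner i)) hM hk (fun _ => rfl)
    (fun _ => rfl) (fun _ => by decide) x i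

theorem tileOf_subdivision_eq (c : X → Fin 5 → Corner) {x y : X} {i j : Fin 5} :
    (labelledSubdivision M c).tileOf (x, i) = (labelledSubdivision M c).tileOf (y, j) ↔ x = y := by
  rw [OrientedMap.tileOf_eq]
  constructor
  · intro h
    exact (iff_of_sameCycle (P := fun d => x = d.1) (fun d hd => hd) h).1 rfl
  · rintro rfl
    refine ⟨((j - i : Fin 5).val : ℕ), ?_⟩
    rw [zpow_natCast, subdivision_next_pow, Fin.ofNat_val_eq_self, add_sub_cancel]

open Classical in
-- A vertex of `S` has only corners `δ`, so it touches a tile only at corner 0; membership in some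
-- `N(v)` is thus decided by the middle point of the tile.
theorem reorient_eq_partialExchange (hM : M.IsTrivalent k) (hk : 0 < k)
    (S : Set ((pentSubdivision M).relabel label4D2).Vertex)
    (hS : ∀ v ∈ S, ((pentSubdivision M).relabel label4D2).cornersAt v = Multiset.replicate k δ) :
    ((pentSubdivision M).relabel label4D2).reorient S = partialExchange M fun x =>
      ((pentSubdivision M).relabel label4D2).vertexOf (x, 0) ∈ S := by
  have key : ∀ d : X × Fin 5, (∃ v ∈ S, ((pentSubdivision M).relabel label4D2).tileOf d ∈
      ((pentSubdivision M).relabel label4D2).nbhd v) ↔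
      ((pentSubdivision M).relabel label4D2).vertexOf (d.1, 0) ∈ S := by
    rintro ⟨x, i⟩
    constructor
    · rintro ⟨v, hv, ⟨y, j⟩, rfl, ht⟩
      obtain rfl : y = x :=
        (tileOf_subdivision_eq fun _ i => label4D2 (subdivisionCorner i)).1 ht
      have h1 := hS _ hv
      rw [cornersAt_4D2 hM hk] at h1
      obtain ⟨n1, n2⟩ := replicate_delta_ne hk
      fin_cases j
      · exact hv
      · exact absurd h1.symm n1
      · exact absurd h1.symm n2
      · exact absurd h1.symm n1
      · exact absurd h1.symm n1
    · intro h
      exact ⟨_, h, (x, 0), rfl,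
        (tileOf_subdivision_eq fun _ i => label4D2 (subdivisionCorner i)).2 rfl⟩
  exact congrArg (CornerMap.mk (pentSubdivision M).toOrientedMap)
    (funext fun d => if_congr (key d) rfl rfl)

/-- Every vertex invariant choice of tiles comes from a set of vertices. -/
theorem exists_reorient_eq (hM : M.IsTrivalent k) (hk : 0 < k) {o : X → Prop}
    (ho : ∀ x, o (M.next x) ↔ o x) :
    ∃ S : Set ((pentSubdivision M).relabel label4D2).Vertex,
      (∀ v ∈ S, ((pentSubdivision M).relabel label4D2).cornersAt v = Multiset.replicate k δ) ∧
      partialExchange M o = ((pentSubdivision M).relabel label4D2).reorient S := by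
  let S : Set ((pentSubdivision M).relabel label4D2).Vertex :=
    {v | ∃ x, o x ∧ ((pentSubdivision M).relabel label4D2).vertexOf (x, 0) = v}
  have hS : ∀ v ∈ S, ((pentSubdivision M).relabel label4D2).cornersAt v =
      Multiset.replicate k δ := by
    rintro v ⟨x, -, rfl⟩
    exact cornersAt_4D2 hM hk x 0
  refine ⟨S, hS, ?_⟩
  rw [reorient_eq_partialExchange hM hk S hS]
  refine partialExchange_congr fun x => ⟨fun hx => ⟨x, hx, rfl⟩, ?_⟩
  rintro ⟨y, hy, hxy⟩
  rw [OrientedMap.vertexOf_eq] at hxy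
  refine ((iff_of_sameCycle (P := fun d => d.2 = 0 ∧ o d.1) ?_ hxy).1 ⟨rfl, hy⟩).2
  rintro ⟨z, i⟩ ⟨hi, hz⟩
  obtain rfl : i = 0 := hi
  have h := (subdivision_around M (fun _ i => label4D2 (subdivisionCorner i)) z).1
  have h' : ((pentSubdivision M).relabel label4D2).around (z, 0) = (M.next z, 0) := h
  rw [h']
  exact ⟨rfl, (ho z).2 hz⟩

end base

/-! ### Classification relative to a universal trivalent map -/

section main
variable {D : Type*} [Finite D] {T : CornerMap D} {X : Type v} [Finite X] {M : OrientedMap X}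
  {k N b g : ℕ}

/-- A tiling with the pattern of the pentagonal subdivision is the pentagonal subdivision of `M`
as soon as `M` can be mapped to it. -/
theorem iso_labelledSubdivision (h : T.IsTilingFor (avcDelta k N b g))
    (hp : IsSubdivisionPattern T.next T.flip (fun d => T.corner d = δ) k) (hN : Nat.card X = N)
    [Nonempty X] {φ : X → {d // T.corner d = δ}} (hn : ∀ x, φ (M.next x) = hp.rotate (φ x))
    (hf : ∀ x, φ (M.flip x) = hp.turn (φ x)) :
    T.Iso (labelledSubdivision M fun x i => T.corner ((T.next ^ (i : ℕ)) (φ x).1)) := by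
  set U := labelledSubdivision M fun x i => T.corner ((T.next ^ (i : ℕ)) (φ x).1) with hU
  let e : X × Fin 5 → D := fun d => (T.next ^ (d.2 : ℕ)) (φ d.1).1
  have e_next : ∀ d, e (U.next d) = T.next (e d) := by
    rintro ⟨x, i⟩
    fin_cases i
    · rfl
    · rfl
    · rfl
    · rfl
    · exact (hp.n5 _).symm
  have hprev : ∀ x, φ x = hp.rotate (φ (M.next⁻¹ x)) := fun x => by
    rw [← hn]; simp
  have e_flip : ∀ d, e (U.flip d) = T.flip (e d) := by
    rintro ⟨x, i⟩
    fin_cases i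
    · change T.next (T.next (T.next (T.next (φ (M.next⁻¹ x)).1))) = T.flip (φ x).1
      rw [hprev x, hp.flip_zero]
    · change T.next (T.next (φ (M.flip (M.next⁻¹ x))).1) = T.flip (T.next (φ x).1)
      rw [hprev x, hp.flip_one, hf]
    · change T.next (φ (M.next (M.flip x))).1 = T.flip (T.next (T.next (φ x).1))
      rw [hp.flip_two, hn, hf]
    · change T.next (T.next (T.next (φ (M.flip x)).1)) = T.flip (T.next (T.next (T.next (φ x).1)))
      rw [hp.flip_three, hf]
    · change (φ (M.next x)).1 = T.flip (T.next (T.next (T.next (T.next (φ x).1))))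
      rw [hp.flip_four, hn]
  have e_surj : Function.Surjective e := by
    intro d
    obtain ⟨x⟩ := ‹Nonempty X›
    refine T.forall_of_connected h.sphere.1 (P := fun d => ∃ a, e a = d) ?_ ?_
      (a := e (x, 0)) ⟨_, rfl⟩ d
    · rintro _ ⟨a, rfl⟩
      exact ⟨_, e_next a⟩
    · rintro _ ⟨a, rfl⟩
      exact ⟨_, e_flip a⟩
  have tile_pow : ∀ (i : ℕ) (d : D), T.tileOf ((T.next ^ i) d) = T.tileOf d := fun i d =>
    T.tileOf_eq.2 (Equiv.Perm.sameCycle_pow_left.2 (Equiv.Perm.SameCycle.refl _ _))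
  have tile_inj : Function.Injective fun x => T.tileOf (φ x).1 := by
    have hs : Function.Surjective fun x => T.tileOf (φ x).1 := by
      intro t
      obtain ⟨d, rfl⟩ := T.tileOf_surjective t
      obtain ⟨⟨x, i⟩, rfl⟩ := e_surj d
      exact ⟨x, (tile_pow _ _).symm⟩
    -- Both sides have `N` tiles, so surjectivity gives injectivity on tiles; within a tile the five
    -- vertices differ.
    exact ((Nat.bijective_iff_surjective_and_card _).2 ⟨hs, hN.trans h.card_tiles.symm⟩).1
  have e_inj : Function.Injective e := by
    rintro ⟨x, i⟩ ⟨y, j⟩ hxy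
    obtain rfl : x = y := tile_inj (by
      have := congrArg T.tileOf hxy
      simpa only [e, tile_pow] using this)
    exact congrArg _ ((h.pentagons (φ x).1).2 (congrArg T.vertexOf hxy))
  exact CornerMap.Iso.of_symm ⟨Equiv.ofBijective e ⟨e_inj, e_surj⟩, e_next, e_flip, fun _ => rfl⟩

/-- `M` can be mapped to every map with the local structure of `M`. -/
def OrientedMap.IsUniversal {X : Type v} (M : OrientedMap X) (k : ℕ) : Prop :=
  ∀ (E : Type w) (A F : E → E), (∀ x, A^[k] x = x) → (∀ x, F (F x) = x) →
    (∀ x, A (F (A (F (A (F x))))) = x) → E →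
    ∃ φ : X → E, (∀ x, φ (M.next x) = A (φ x)) ∧ ∀ x, φ (M.flip x) = F (φ x)

theorem exists_iso_of_isSubdivisionPattern {D : Type w} [Finite D] {T : CornerMap D}
    (h : T.IsTilingFor (avcDelta k N b g))
    (hp : IsSubdivisionPattern T.next T.flip (fun d => T.corner d = δ) k) (hM : M.IsTrivalent k)
    (hu : OrientedMap.IsUniversal.{v, w} M k) (hk : 0 < k) (hN : Nat.card X = N) (hN0 : 0 < N) :
    ∃ U : CornerMap (X × Fin 5),
      (U = (pentSubdivision M).relabel label4D1 ∨ U = (pentSubdivision M).relabel label4D2 ∨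
        U = (pentSubdivision M).relabel label4D3 ∨
        ∃ S : Set ((pentSubdivision M).relabel label4D2).Vertex,
          (∀ v ∈ S, ((pentSubdivision M).relabel label4D2).cornersAt v =
            Multiset.replicate k Corner.δ) ∧
          U = ((pentSubdivision M).relabel label4D2).reorient S) ∧
      (T.Iso U ∨ T.Iso U.exchange) := by
  have : Nonempty X := (Nat.card_pos_iff.1 (hN ▸ hN0)).1
  obtain ⟨s₁, s₂, s₃, s₄, hs, hex, ha⟩ := CornerMap.exists_arrangement_from_delta h
  have hE : Nonempty {d // T.corner d = δ} := by
    have : Nonempty T.Tile := (Nat.card_pos_iff.1 (by rw [h.card_tiles]; exact hN0)).1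
    obtain ⟨t⟩ := this
    obtain ⟨d, -⟩ := T.tileOf_surjective t
    obtain ⟨i, -, hi⟩ := hex d
    exact ⟨_, hi⟩
  obtain ⟨φ, hn, hf⟩ := hu _ hp.rotate hp.turn hp.rotate_iterate hp.turn_turn hp.rotate_turn
    hE.some
  have hiso := iso_labelledSubdivision h hp hN hn hf
  have hpair : ∀ d : {d // T.corner d = δ},
      T.corner (T.next (T.next d.1)) = s₂ ∨ T.corner (T.next (T.next d.1)) = s₃ := fun d =>
    (ha d.1 d.2).imp (fun e => e.2.1) (fun e => e.2.1)
  have h2 : ∀ d : {d // T.corner d = δ}, T.corner (T.next (T.next d.1)) = α := by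
    intro d
    have h3 := (h.three_of_ne_delta (hp.not_delta d.1 d.2).2.1).2
    rw [hp.flip_two, hp.flip_two] at h3
    -- All three corners at this vertex are corners number 2, with values in `{s₂, s₃}`.
    exact eq_alpha_of_pair (hpair _) (hpair _) (hpair _) h3
  have h1 : ∀ d : {d // T.corner d = δ},
      ({T.corner (T.next (hp.rotate d).1), T.corner (T.next (T.next (T.next (T.next d.1)))),
        T.corner (T.next (T.next (T.next (hp.turn d).1)))} : Multiset Corner) = {α, β, γ} ∨
      ({T.corner (T.next (hp.rotate d).1), T.corner (T.next (T.next (T.next (T.next d.1)))),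
        T.corner (T.next (T.next (T.next (hp.turn d).1)))} : Multiset Corner) = {α, α, α} := by
    intro d
    have h3 := (h.three_of_ne_delta (hp.not_delta _ (hp.rotate d).2).1).2
    rwa [hp.flip_one, hp.flip_three, hp.turn_turn] at h3
  have hcases := corner_cases (E := {d // T.corner d = δ}) (rotate := hp.rotate) (turn := hp.turn)
    (c₁ := fun d => T.corner (T.next d.1)) (c₂ := fun d => T.corner (T.next (T.next d.1)))
    (c₃ := fun d => T.corner (T.next (T.next (T.next d.1))))
    (c₄ := fun d => T.corner (T.next (T.next (T.next (T.next d.1))))) hs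
    (fun d => ha d.1 d.2) h2 h1
  have hlabel : ∀ (l : Corner → Corner), l ε = δ → l δ = α →
      (∀ x, T.corner (T.next (φ x).1) = l α ∧ T.corner (T.next (T.next (T.next (φ x).1))) = l β ∧
        T.corner (T.next (T.next (T.next (T.next (φ x).1)))) = l γ) →
      labelledSubdivision M (fun x i => T.corner ((T.next ^ (i : ℕ)) (φ x).1)) =
        (pentSubdivision M).relabel l := by
    intro l l0 l2 hl
    change _ = labelledSubdivision M fun _ i => l (subdivisionCorner i)
    congr 1
    funext x i
    fin_cases i
    · exact (φ x).2.trans l0.symm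
    · exact (hl x).1
    · exact (h2 (φ x)).trans l2.symm
    · exact (hl x).2.1
    · exact (hl x).2.2
  rcases hcases with hc | hc | hc | hc | hc
  · exact ⟨_, .inl rfl, .inl (hlabel label4D1 rfl rfl (fun x => hc _) ▸ hiso)⟩
  · refine ⟨_, .inl rfl, .inr ?_⟩
    rw [hlabel (Equiv.swap β γ ∘ label4D1) rfl rfl (fun x => hc _)] at hiso
    exact hiso
  · exact ⟨_, .inr (.inr (.inl rfl)), .inl (hlabel label4D3 rfl rfl (fun x => hc _) ▸ hiso)⟩
  · refine ⟨_, .inr (.inr (.inl rfl)), .inr ?_⟩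
    rw [hlabel (Equiv.swap β γ ∘ label4D3) rfl rfl (fun x => hc _)] at hiso
    exact hiso
  · obtain ⟨S, hS, hS'⟩ := exists_reorient_eq hM hk (o := fun x => T.corner (T.next (φ x).1) = γ)
      (fun x => by rw [hn, (hc _).2.2])
    refine ⟨_, .inr (.inr (.inr ⟨S, hS, rfl⟩)), .inl ?_⟩
    rw [← hS']
    convert hiso using 1
    refine congrArg (labelledSubdivision M) (funext fun x => funext fun i => ?_)
    obtain ⟨e3, ⟨e1, e4⟩ | ⟨e1, e4⟩, -⟩ := hc (φ x)
    · rw [exchangeCorner_of_not (fun h => absurd (h.symm.trans e1) (by decide))]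
      fin_cases i
      · exact (φ x).2.symm
      · exact e1.symm
      · exact (h2 (φ x)).symm
      · exact e3.symm
      · exact e4.symm
    · rw [exchangeCorner_of (o := fun x => T.corner (T.next (φ x).1) = γ) e1]
      fin_cases i
      · exact (φ x).2.symm
      · exact e1.symm
      · exact (h2 (φ x)).symm
      · exact e3.symm
      · exact e4.symm

/-- The classification of the tilings for `avcDelta k N b g`, when there is a universal trivalent
map with `k`-gonal tiles. -/
theorem isTilingFor_avcDelta_iff {D : Type w} [Finite D] (T : CornerMap D) (hM : M.IsTrivalent k)
    (hu : OrientedMap.IsUniversal.{v, w} M k) (hk : 1 < k) (hN : Nat.card X = N) (hN0 : 0 < N) (hb : 3 * b = N)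
    (hg : k * g = N) (euler : 2 * (N + b + g + N) = 5 * N + 4) :
    T.IsTilingFor (avcDelta k N b g) ↔ ∃ U : CornerMap (X × Fin 5),
      (U = (pentSubdivision M).relabel label4D1 ∨ U = (pentSubdivision M).relabel label4D2 ∨
        U = (pentSubdivision M).relabel label4D3 ∨
        ∃ S : Set ((pentSubdivision M).relabel label4D2).Vertex,
          (∀ v ∈ S, ((pentSubdivision M).relabel label4D2).cornersAt v =
            Multiset.replicate k Corner.δ) ∧
          U = ((pentSubdivision M).relabel label4D2).reorient S) ∧
      (T.SameTiling U ∨ T.SameTiling U.exchange) := by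
  constructor
  · intro h
    rcases h.isSubdivisionPattern_or_mirror (by omega) with hp | hp
    · obtain ⟨U, hU, h1 | h1⟩ :=
        exists_iso_of_isSubdivisionPattern h hp hM hu (by omega) hN hN0
      · exact ⟨U, hU, .inl (.inl h1)⟩
      · exact ⟨U, hU, .inr (.inl h1)⟩
    · obtain ⟨U, hU, h1 | h1⟩ :=
        exists_iso_of_isSubdivisionPattern h.mirror hp hM hu (by omega) hN hN0
      · exact ⟨U, hU, .inl (.inr h1.mirror_right)⟩
      · exact ⟨U, hU, .inr (.inr h1.mirror_right)⟩
  · rintro ⟨U, hU, h⟩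
    have hT : U.IsTilingFor (avcDelta k N b g) := by
      rcases hU with rfl | rfl | rfl | ⟨S, hS, rfl⟩
      · exact isTilingFor_4D1 hM hk hN hb hg euler
      · rw [relabel_eq_partialExchange]
        exact isTilingFor_partialExchange hM hk hN hb hg euler fun _ => Iff.rfl
      · exact isTilingFor_4D3 hM hk hN hb hg euler
      · rw [reorient_eq_partialExchange hM (by omega) S hS]
        exact isTilingFor_partialExchange hM hk hN hb hg euler fun x => by rw [vertexOf_middle]
    exact h.elim hT.of_sameTiling hT.exchange.of_sameTiling

end main

/-! ### Universality of the cube and the dodecahedron -/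

theorem forall_of_add_one {k : ℕ} [NeZero k] {P : Fin k → Prop} (h : ∀ i, P i → P (i + 1))
    {i : Fin k} (hi : P i) (j : Fin k) : P j := by
  have key : ∀ n : ℕ, P (i + Fin.ofNat k n) := by
    intro n
    induction n with
    | zero => simpa using hi
    | succ n ih =>
      have h1 := h _ ih
      rw [add_assoc] at h1
      convert h1 using 2
      ext
      simp [Fin.val_add]
  have h1 := key (j - i).val
  rwa [Fin.ofNat_val_eq_self, add_sub_cancel] at h1

/-- An equivariance that holds at some sides spreads by going around the vertices of degree `3`.
The order in which this happens is given by `r`. -/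
theorem flip_equivariant_of_rank {X : Type v} {M : OrientedMap X} {k : ℕ} (hM : M.IsTrivalent k)
    {E : Type w} {A F : E → E} (hA : Function.Injective A) (hF : ∀ x, F (F x) = x)
    (hAF : ∀ x, A (F (A (F (A (F x))))) = x) {φ : X → E} (hn : ∀ x, φ (M.next x) = A (φ x))
    (r : X → ℕ) (h0 : ∀ x, r x = 0 → φ (M.flip x) = F (φ x))
    (hr : ∀ x, r x ≠ 0 → r (M.flip x) < r x ∨
      (r (M.next (M.flip x)) < r x ∧ r (M.next (M.flip (M.next (M.flip x)))) < r x)) (x : X) :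
    φ (M.flip x) = F (φ x) := by
  induction hx : r x using Nat.strong_induction_on generalizing x with
  | _ m ih =>
    subst hx
    by_cases h : r x = 0
    · exact h0 x h
    rcases hr x h with h1 | ⟨h1, h2⟩
    · have := ih _ h1 _ rfl
      rw [M.flip_flip] at this
      rw [this, hF]
    · have e1 := ih _ h1 _ rfl
      have e2 := ih _ h2 _ rfl
      have h3 : M.next (M.flip (M.next (M.flip (M.next (M.flip x))))) = x := by
        have := hM.around_pow x
        change M.around (M.around (M.around x)) = x at this
        rw [← Equiv.Perm.eq_inv_iff_eq, ← Equiv.Perm.eq_inv_iff_eq, ← Equiv.Perm.eq_inv_iff_eq] at this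
        simpa only [OrientedMap.around_inv_apply] using this.symm
      have e3 := hn (M.flip (M.next (M.flip (M.next (M.flip x)))))
      rw [h3, e2, hn, e1] at e3
      -- Two of the three edges at the starting point of `x` are known to be respected; the relation
      -- `(A F)³ = 1` forces the third.
      have e4 := hAF (φ (M.next (M.flip x)))
      rw [← e3, hn] at e4
      exact (hA e4).symm

section ofFaces
variable {n k m : ℕ} [NeZero k] {F : Fin n → Fin k → Fin m} {G : Fin n → Fin k → Fin n × Fin k}
  {hF : ∀ f i, F (G f i).1 (G f i).2 = F f (i + 1) ∧ F (G f i).1 ((G f i).2 + 1) = F f i}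
  {h : ∀ f i, G (G f i).1 (G f i).2 = (f, i)} {h' : ∀ f i, G f i ≠ (f, i)}

theorem face_iterate_next {E : Type*} {A : E → E} (hA : ∀ x, A^[k] x = x) (b : Fin n → E)
    (x : Fin n × Fin k) :
    A^[((ofFaces F G hF h h').next x).2] (b ((ofFaces F G hF h h').next x).1) =
      A (A^[x.2] (b x.1)) := by
  obtain ⟨f, i⟩ := x
  change A^[(i + 1 : Fin k).val] (b f) = A (A^[i.val] (b f))
  rw [← Function.iterate_succ_apply' A]
  rcases Nat.lt_or_ge (i.val + 1) k with hi | hi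
  · rw [Fin.val_add_one_of_lt' hi]
  · have h1 : i.val + 1 = k := by omega
    have h2 : (i + 1 : Fin k).val = 0 := by
      rw [Fin.val_add]
      simp [h1]
    rw [h2, Nat.succ_eq_add_one, h1, hA]
    rfl

end ofFaces

theorem cube_isTrivalent : cube.IsTrivalent 4 where
  next_pow := by decide +kernel
  next_pow_ne := by
    intro x j h0 h4
    revert x
    interval_cases j <;> decide +kernel
  around_pow := by decide +kernel
  around_ne := by decide +kernel
  connected := by
    refine cube.connected_of_induction (0, 0) fun P hn hf h0 => ?_
    have hrow : ∀ f i, P (f, i) → ∀ j, P (f, j) := fun f i hi =>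
      forall_of_add_one (P := fun j => P (f, j)) (fun j hj => hn _ hj) hi
    have r0 := hrow 0 0 h0
    have r1 := hrow 1 0 (hf _ (r0 0))
    have r2 := hrow 2 0 (hf _ (r0 1))
    have r3 := hrow 3 0 (hf _ (r0 2))
    have r4 := hrow 4 0 (hf _ (r0 3))
    have r5 := hrow 5 2 (hf _ (r1 2))
    rintro ⟨f, i⟩
    fin_cases f
    exacts [r0 i, r1 i, r2 i, r3 i, r4 i, r5 i]

theorem cube_isUniversal : OrientedMap.IsUniversal.{0, w} cube 4 := by
  intro E A F hA hF hAF e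
  have hinj : Function.Injective A := fun x y hxy => by
    rw [← hA x, ← hA y, Function.iterate_succ_apply, hxy]; rfl
  -- The images of the sides `(f, 0)`, carried along a spanning tree of faces: from the top to the
  -- four sides, and from face 1 to the bottom. The outer `A^[2]` appears because `(1, 2)` is glued
  -- to `(5, 2)`, two steps from `(5, 0)`.
  let b : Fin 6 → E := ![e, F e, F (A e), F (A^[2] e), F (A^[3] e), A^[2] (F (A^[2] (F e)))]
  let φ : Fin 6 × Fin 4 → E := fun x => A^[x.2] (b x.1)
  have hn : ∀ x, φ (cube.next x) = A (φ x) := by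
    unfold cube
    exact face_iterate_next hA b
  refine ⟨φ, hn, flip_equivariant_of_rank cube_isTrivalent hinj hF hAF hn
    -- Rank 0 marks the sides at which the tree is crossed away from the top; the other ranks give
    -- an order in which vertices of degree 3 determine the remaining sides.
    (fun x => (![![0, 0, 0, 0], ![1, 2, 0, 3], ![1, 2, 4, 3], ![1, 2, 6, 3], ![1, 2, 5, 3], ![6, 5, 1, 4]] : Fin 6 → Fin 4 → ℕ) x.1 x.2)
    ?_ (by decide +kernel)⟩
  have key : ∀ x : Fin 6 × Fin 4, (![![0, 0, 0, 0], ![1, 2, 0, 3], ![1, 2, 4, 3], ![1, 2, 6, 3], ![1, 2, 5, 3], ![6, 5, 1, 4]] : Fin 6 → Fin 4 → ℕ) x.1 x.2 = 0 →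
      x.1 = 0 ∨ x = (1, 2) := by decide +kernel
  intro x hx
  rcases key x hx with h | rfl
  · obtain ⟨f, i⟩ := x
    obtain rfl : f = 0 := h
    fin_cases i <;> rfl
  · exact hA (F (A^[2] (F e)))

theorem dodecahedron_isTrivalent : dodecahedron.IsTrivalent 5 where
  next_pow := by decide +kernel
  next_pow_ne := by
    intro x j h0 h4
    revert x
    interval_cases j <;> decide +kernel
  around_pow := by decide +kernel
  around_ne := by decide +kernel
  connected := by
    refine dodecahedron.connected_of_induction (0, 0) fun P hn hf h0 => ?_
    have hrow : ∀ f i, P (f, i) → ∀ j, P (f, j) := fun f i hi =>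
      forall_of_add_one (P := fun j => P (f, j)) (fun j hj => hn _ hj) hi
    have r0 := hrow 0 0 h0
    have r1 := hrow 1 0 (hf _ (r0 0))
    have r2 := hrow 2 0 (hf _ (r0 1))
    have r3 := hrow 3 0 (hf _ (r0 2))
    have r4 := hrow 4 0 (hf _ (r0 3))
    have r5 := hrow 5 0 (hf _ (r0 4))
    have r6 := hrow 6 0 (hf _ (r1 3))
    have r7 := hrow 7 0 (hf _ (r2 3))
    have r8 := hrow 8 0 (hf _ (r3 3))
    have r9 := hrow 9 0 (hf _ (r4 3))
    have r10 := hrow 10 0 (hf _ (r5 3))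
    have r11 := hrow 11 3 (hf _ (r6 2))
    rintro ⟨f, i⟩
    fin_cases f
    exacts [r0 i, r1 i, r2 i, r3 i, r4 i, r5 i, r6 i, r7 i, r8 i, r9 i, r10 i, r11 i]

theorem dodecahedron_isUniversal : OrientedMap.IsUniversal.{0, w} dodecahedron 5 := by
  intro E A F hA hF hAF e
  have hinj : Function.Injective A := fun x y hxy => by
    rw [← hA x, ← hA y, Function.iterate_succ_apply, hxy]; rfl
  -- The tree goes from the top to the upper faces, through their sides 3 to the lower faces, and
  -- through `(6, 2)`, glued to `(11, 3)`, to the bottom; there `A^[2]` undoes `A^[3]`.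
  let b : Fin 12 → E := ![e, F e, F (A e), F (A^[2] e), F (A^[3] e), F (A^[4] e),
    F (A^[3] (F e)), F (A^[3] (F (A e))), F (A^[3] (F (A^[2] e))), F (A^[3] (F (A^[3] e))),
    F (A^[3] (F (A^[4] e))), A^[2] (F (A^[2] (F (A^[3] (F e)))))]
  let φ : Fin 12 × Fin 5 → E := fun x => A^[x.2] (b x.1)
  have hn : ∀ x, φ (dodecahedron.next x) = A (φ x) := by
    unfold dodecahedron
    exact face_iterate_next hA b
  refine ⟨φ, hn, flip_equivariant_of_rank dodecahedron_isTrivalent hinj hF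
    hAF hn (fun x => (![![0, 0, 0, 0, 0], ![1, 2, 4, 0, 3], ![1, 2, 4, 0, 3], ![1, 2, 4, 0, 3], ![1, 2, 4, 0, 3], ![1, 2, 4, 0, 3], ![1, 6, 0, 7, 5], ![1, 6, 8, 7, 5], ![1, 6, 10, 7, 5], ![1, 6, 11, 7, 5], ![1, 6, 9, 7, 5], ![10, 11, 9, 1, 8]] : Fin 12 → Fin 5 → ℕ) x.1 x.2)
    ?_ (by decide +kernel)⟩
  have key : ∀ x : Fin 12 × Fin 5, (![![0, 0, 0, 0, 0], ![1, 2, 4, 0, 3], ![1, 2, 4, 0, 3], ![1, 2, 4, 0, 3], ![1, 2, 4, 0, 3], ![1, 2, 4, 0, 3], ![1, 6, 0, 7, 5], ![1, 6, 8, 7, 5], ![1, 6, 10, 7, 5], ![1, 6, 11, 7, 5], ![1, 6, 9, 7, 5], ![10, 11, 9, 1, 8]] : Fin 12 → Fin 5 → ℕ) x.1 x.2 = 0 →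
      x.1 = 0 ∨ (x.1 ≠ 0 ∧ x.1 < 6 ∧ x.2 = 3) ∨ x = (6, 2) := by decide +kernel
  rintro ⟨f, i⟩ hx
  rcases key _ hx with h | ⟨h0, h6, h3⟩ | h
  · obtain rfl : f = 0 := h
    fin_cases i <;> rfl
  · obtain rfl : i = 3 := h3
    fin_cases f
    all_goals first
      | rfl
      | exact absurd rfl h0
      | exact absurd h6 (by decide +kernel)
  · obtain ⟨rfl, rfl⟩ := Prod.mk.inj h
    exact hA (F (A^[2] (F (A^[3] (F e)))))

end PentTiling

open PentTiling in
theorem theorem11 {D : Type*} [Finite D] (T : CornerMap D) :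
    (T.IsTilingFor avc4D24 ↔
      ∃ U : CornerMap ((Fin 6 × Fin 4) × Fin 5),
        (U = PP6.relabel label4D1 ∨ U = PP6.relabel label4D2 ∨ U = PP6.relabel label4D3 ∨
          ∃ S : Set (PP6.relabel label4D2).Vertex,
            (∀ v ∈ S, (PP6.relabel label4D2).cornersAt v = Multiset.replicate 4 Corner.δ) ∧
            U = (PP6.relabel label4D2).reorient S) ∧
        (T.SameTiling U ∨ T.SameTiling U.exchange)) ∧
    (T.IsTilingFor avc4D60 ↔
      ∃ U : CornerMap ((Fin 12 × Fin 5) × Fin 5),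
        (U = PP12.relabel label4D1 ∨ U = PP12.relabel label4D2 ∨ U = PP12.relabel label4D3 ∨
          ∃ S : Set (PP12.relabel label4D2).Vertex,
            (∀ v ∈ S, (PP12.relabel label4D2).cornersAt v = Multiset.replicate 5 Corner.δ) ∧
            U = (PP12.relabel label4D2).reorient S) ∧
        (T.SameTiling U ∨ T.SameTiling U.exchange)) := by
  rw [avc4D24_eq, avc4D60_eq]
  exact ⟨isTilingFor_avcDelta_iff T cube_isTrivalent cube_isUniversal (by norm_num) (by simp) (by norm_num)
      rfl rfl rfl,
    isTilingFor_avcDelta_iff T dodecahedron_isTrivalent dodecahedron_isUniversal (by norm_num)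
      (by simp) (by norm_num) rfl rfl rfl⟩
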